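/- Let $B=(B(x))_{x\in\mathbb{R}}$ be a two-sided standard Brownian motion (with $B(0)=0$ and almost surely continuous paths). For $t>0$ and $x\in\mathbb{R}$ let $$V(t,x)=\int_{\mathbb{R}}\frac{e^{-(x-y)^2/(4t)}}{\sqrt{4\pi t}}\,B(y)\,dy ,\qquad u(t,x)=-\partial_x V(t,x).$$ For $t>0$, the sets of stable and of unstable zeros of $u(t,\cdot)$ are $$\mathcal Z^{\mathrm s}_t=\{x: u(t,x)=0,\ \partial_x u(t,x)<0\},\qquad \mathcal Z^{\mathrm u}_t=\{x: u(t,x)=0,\ \partial_x u(t,x)>0\}.$$ **Lemma 2.3.** Almost surely, for every $t>0$ and every $x\in\mathcal Z^{\mathrm s}_t\cup\mathcal Z^{\mathrm u}_t$, there exists a unique continuous function $r_{(t,x)}:[0,t]\to\mathbb{R}$ such that $r_{(t,x)}(t)=x$ and $u(s,r_{(t,x)}(s))=0$ for all $0<s\le t$. Moreover, if $x\in\mathcal Z^{\mathrm s}_t$ then $r_{(t,x)}(s)\in\mathcal Z^{\mathrm s}_s$ for all $0<s\le t$, and if $x\in\mathcal Z^{\mathrm u}_t$ then $r_{(t,x)}(s)\in\mathcal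 Z^{\mathrm u}_s$ for all $0<s\le t$. The function $r_{(t,x)}$ is $C^\infty$ on $(0,t)$, and for all $0<s\le t$ (with a left derivative at $s=t$) $$\partial_s r_{(t,x)}(s)=-\frac{\partial_s u(s,r_{(t,x)}(s))}{\partial_x u(s,r_{(t,x)}(s))}=-\frac{\partial^2_{xx}u(s,r_{(t,x)}(s))}{\partial_x u(s,r_{(t,x)}(s))}.$$ -/

import Mathlib

open MeasureTheory ProbabilityTheory Set
open scoped NNReal

namespace RandomHeat

/-- A two-sided standard Brownian motion `B = (B x)` indexed by `x : ℝ`: the processes `x ↦ B x`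
and `x ↦ B (-x)`, for `x ≥ 0`, are independent standard Brownian motions started from `0`
(with almost surely continuous paths). -/
structure IsTwoSidedBrownian {Ω : Type*} [MeasurableSpace Ω] (B : ℝ → Ω → ℝ) (P : Measure Ω) :
    Prop where
  right : IsBrownianReal (fun (x : ℝ≥0) ω => B (x : ℝ) ω) P
  left : IsBrownianReal (fun (x : ℝ≥0) ω => B (-(x : ℝ)) ω) P
  indep : IndepFun (fun ω (x : ℝ≥0) => B (x : ℝ) ω) (fun ω (x : ℝ≥0) => B (-(x : ℝ)) ω) P

/-- The heat kernel `P_t(x) = exp (-x² / (4 t)) / √(4 π t)`, for `t > 0`. -/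
noncomputable def heatKernel (t x : ℝ) : ℝ :=
  Real.exp (-x ^ 2 / (4 * t)) / Real.sqrt (4 * Real.pi * t)

/-- The potential `V(t, x) = ∫ P_t(x - y) b(y) dy` for `t > 0`, i.e. the solution of the heat
equation `∂ₜ V = ∂ₓₓ V` started from the path `b`. -/
noncomputable def potential (b : ℝ → ℝ) (t x : ℝ) : ℝ :=
  ∫ y, heatKernel t (x - y) * b y

/-- The velocity field `u = -∂ₓ V`. -/
noncomputable def velocity (b : ℝ → ℝ) (t x : ℝ) : ℝ :=
  -deriv (fun z => potential b t z) x

/-- The partial derivative `∂ₜ u` of a field `u = u(t, x)`. -/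
noncomputable def partialT (u : ℝ → ℝ → ℝ) (t x : ℝ) : ℝ := deriv (fun s => u s x) t

/-- The partial derivative `∂ₓ u` of a field `u = u(t, x)`. -/
noncomputable def partialX (u : ℝ → ℝ → ℝ) (t x : ℝ) : ℝ := deriv (fun z => u t z) x

/-- The stable zeros of `u(t, ·)`. -/
def stableZeros (u : ℝ → ℝ → ℝ) (t : ℝ) : Set ℝ := {x | u t x = 0 ∧ partialX u t x < 0}

/-- The unstable zeros of `u(t, ·)`. -/
def unstableZeros (u : ℝ → ℝ → ℝ) (t : ℝ) : Set ℝ := {x | u t x = 0 ∧ 0 < partialX u t x}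

/-- `r`, restricted to `[0, t]`, is a continuous curve of zeros of `u` that ends at `x` at
time `t`. The values of `r` outside `[0, t]` play no role. -/
structure IsZeroCurve (u : ℝ → ℝ → ℝ) (t x : ℝ) (r : ℝ → ℝ) : Prop where
  continuousOn : ContinuousOn r (Icc 0 t)
  endpoint : r t = x
  zero : ∀ s ∈ Ioc 0 t, u s (r s) = 0

end RandomHeat

/-! Zeros of `u` are critical points of `V`, and simple ones continue locally by the implicit
function theorem. The point is to continue a stable zero backwards to time `0`; unstable zeros
follow by replacing `V` with `-V`. Along a curve of stable zeros `V_x = 0` and `V_t = V_xx = -u_x >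
0`, so `V` increases with time (`monotoneOn_potential`). Backwards, the curve therefore stays below
the level `V t x`, and it cannot cross far points where `V` exceeds that level during all of `(0,
t]` (`bounded`). It cannot oscillate at its lower end either: it would revisit, at arbitrarily small
later times, two points where `V` has different limits (`exists_limit`). At a positive lower end the
limit is a zero with `u_x ≤ 0`. If `u_x = 0`, then `u_t = u_xx ≠ 0` forces nearby zeros into the
past (`eventually_le_of_double_zero`), a contradiction; so the limit is stable and the curve extends
(`exists_isStableCurve`).

This uses three almost sure properties of the Brownian path. The initial values are nowhere
constant, and `V` converges to them at rational points. There are arbitrarily far high and low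
points, on both sides, that survive smoothing by the heat kernel; Borel–Cantelli along a very sparse
sequence gives them (`ae_hasHighPoints`). Finally `u` has no triple zero: this would be three
equations for the two unknowns `(t, x)`. To make this rigorous, three independent Gaussian
increments are split off the path. Given the rest, the heights that create a triple zero form the
differentiable image of a half-plane in `ℝ³`, a null set (`volume_tripleZeroParams`), and Fubini
concludes. -/

/-! ### Smooth fields near simple and double zeros. -/

namespace RandomHeat

open Filter Topology
open scoped ContDiff

/-- `f = f(t, x)` is jointly smooth at all times `t > 0`. -/
def SmoothField (f : ℝ → ℝ → ℝ) : Prop :=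
  ∀ t x, 0 < t → ContDiffAt ℝ ∞ (fun p : ℝ × ℝ => f p.1 p.2) (t, x)

namespace SmoothField

variable {f : ℝ → ℝ → ℝ} {t x : ℝ}

lemma continuousAt (hf : SmoothField f) (ht : 0 < t) :
    ContinuousAt (fun p : ℝ × ℝ => f p.1 p.2) (t, x) :=
  (hf t x ht).continuousAt

lemma hasFDerivAt (hf : SmoothField f) (ht : 0 < t) :
    HasFDerivAt (fun p : ℝ × ℝ => f p.1 p.2)
      (fderiv ℝ (fun p : ℝ × ℝ => f p.1 p.2) (t, x)) (t, x) :=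
  ((hf t x ht).differentiableAt (by simp)).hasFDerivAt

lemma hasDerivAt_fderiv_snd (hf : SmoothField f) (ht : 0 < t) :
    HasDerivAt (fun z => f t z) (fderiv ℝ (fun p : ℝ × ℝ => f p.1 p.2) (t, x) (0, 1)) x := by
  have h := (hf.hasFDerivAt ht (x := x)).comp_hasDerivAt x
    ((hasDerivAt_const x t).prodMk (hasDerivAt_id x))
  simpa using! h

lemma hasDerivAt_fderiv_fst (hf : SmoothField f) (ht : 0 < t) :
    HasDerivAt (fun s => f s x) (fderiv ℝ (fun p : ℝ × ℝ => f p.1 p.2) (t, x) (1, 0)) t := by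
  have h := (hf.hasFDerivAt ht (x := x)).comp_hasDerivAt t
    ((hasDerivAt_id t).prodMk (hasDerivAt_const t x))
  simpa using! h

lemma partialX_eq (hf : SmoothField f) (ht : 0 < t) :
    partialX f t x = fderiv ℝ (fun p : ℝ × ℝ => f p.1 p.2) (t, x) (0, 1) :=
  (hf.hasDerivAt_fderiv_snd ht).deriv

lemma partialT_eq (hf : SmoothField f) (ht : 0 < t) :
    partialT f t x = fderiv ℝ (fun p : ℝ × ℝ => f p.1 p.2) (t, x) (1, 0) :=
  (hf.hasDerivAt_fderiv_fst ht).deriv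

lemma hasDerivAt_partialX (hf : SmoothField f) (ht : 0 < t) :
    HasDerivAt (fun z => f t z) (partialX f t x) x := by
  rw [hf.partialX_eq ht]; exact hf.hasDerivAt_fderiv_snd ht

lemma hasDerivAt_partialT (hf : SmoothField f) (ht : 0 < t) :
    HasDerivAt (fun s => f s x) (partialT f t x) t := by
  rw [hf.partialT_eq ht]; exact hf.hasDerivAt_fderiv_fst ht

lemma hasDerivAt_comp (hf : SmoothField f) (ht : 0 < t) {r : ℝ → ℝ} {r' : ℝ}
    (hr : HasDerivAt r r' t) :
    HasDerivAt (fun s => f s (r s)) (partialT f t (r t) + partialX f t (r t) * r') t := by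
  have h := (hf.hasFDerivAt ht (x := r t)).comp_hasDerivAt t ((hasDerivAt_id t).prodMk hr)
  convert! h using 1
  rw [hf.partialX_eq ht, hf.partialT_eq ht]
  have : ((1 : ℝ), r') = (1, 0) + r' • ((0 : ℝ), (1 : ℝ)) := by simp
  rw [this, map_add, map_smul, smul_eq_mul, mul_comm r']

lemma fderiv_apply (hf : SmoothField f) (v : ℝ × ℝ) :
    SmoothField fun t x => fderiv ℝ (fun p : ℝ × ℝ => f p.1 p.2) (t, x) v := fun t x ht =>
  ((hf t x ht).fderiv_right (m := ∞) (by simp)).clm_apply contDiffAt_const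

lemma congr {g : ℝ → ℝ → ℝ} (hf : SmoothField f) (h : ∀ t x, 0 < t → g t x = f t x) :
    SmoothField g := fun t x ht => by
  refine (hf t x ht).congr_of_eventuallyEq ?_
  filter_upwards [continuousAt_fst.eventually (lt_mem_nhds ht)] with p hp using h _ _ hp

lemma partialX (hf : SmoothField f) : SmoothField (RandomHeat.partialX f) :=
  (hf.fderiv_apply (0, 1)).congr fun _ _ ht => hf.partialX_eq ht

lemma partialT (hf : SmoothField f) : SmoothField (RandomHeat.partialT f) :=
  (hf.fderiv_apply (1, 0)).congr fun _ _ ht => hf.partialT_eq ht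

lemma neg (hf : SmoothField f) : SmoothField fun t x => -f t x := fun t x ht => (hf t x ht).neg

end SmoothField

lemma partialX_neg (f : ℝ → ℝ → ℝ) :
    partialX (fun t x => -f t x) = fun t x => -partialX f t x := by
  ext t x; simp [partialX]

lemma partialT_neg (f : ℝ → ℝ → ℝ) :
    partialT (fun t x => -f t x) = fun t x => -partialT f t x := by
  ext t x; simp [partialT]

/-- Near a simple zero, the zero set of a smooth field is the graph of a smooth function. -/
lemma exists_local_zero_curve {u : ℝ → ℝ → ℝ} (hu : SmoothField u) {t x : ℝ} (ht : 0 < t)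
    (h0 : u t x = 0) (hx : partialX u t x ≠ 0) :
    ∃ φ : ℝ → ℝ, φ t = x ∧ ContDiffAt ℝ ∞ φ t ∧
      HasDerivAt φ (-(partialT u t x / partialX u t x)) t ∧
      ∀ᶠ p in 𝓝 (t, x), u p.1 p.2 = 0 ↔ p.2 = φ p.1 := by
  have cdf := hu t x ht
  have inv : (fderiv ℝ (fun p : ℝ × ℝ => u p.1 p.2) (t, x) ∘L .inr ℝ ℝ ℝ).IsInvertible := by
    refine ⟨ContinuousLinearEquiv.unitsEquivAut ℝ (Units.mk0 _ hx), ?_⟩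
    ext
    simp [hu.partialX_eq ht]
  have hn : (∞ : ℕ∞ω) ≠ 0 := by simp
  have hev := cdf.eventually_apply_eq_iff_implicitFunction hn inv
  have hself := cdf.implicitFunction_apply_self hn inv
  have hcd := cdf.contDiffAt_implicitFunction hn inv
  set φ := cdf.implicitFunction hn inv
  refine ⟨φ, hself, hcd, ?_, ?_⟩
  · have hd : HasDerivAt φ (deriv φ t) t := (hcd.differentiableAt (by simp)).hasDerivAt
    have h1 := hu.hasDerivAt_comp ht hd
    have h2 : (fun s => u s (φ s)) =ᶠ[𝓝 t] fun _ => 0 := by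
      have := cdf.eventually_apply_implicitFunction hn inv
      filter_upwards [this] with s hs
      simpa [h0] using hs
    have h3 := h1.unique ((hasDerivAt_const t (0 : ℝ)).congr_of_eventuallyEq h2)
    have hself' : φ t = x := hself
    rw [hself'] at h3
    convert hd using 1
    field_simp
    linarith
  · filter_upwards [hev] with p hp
    simp only [h0] at hp
    rw [hp, eq_comm]

/-- For a solution of the heat equation, all the zeros near a double zero belong to the past. -/
lemma eventually_le_of_double_zero {u : ℝ → ℝ → ℝ} (hu : SmoothField u)
    (heat : ∀ t x, 0 < t → partialT u t x = partialX (partialX u) t x) {t x : ℝ} (ht : 0 < t)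
    (h0 : u t x = 0) (hx : partialX u t x = 0) (hxx : partialX (partialX u) t x ≠ 0) :
    ∀ᶠ p in 𝓝 (t, x), u p.1 p.2 = 0 → p.1 ≤ t := by
  wlog hpos : 0 < partialX (partialX u) t x generalizing u
  · have := this (u := fun t x => -u t x) hu.neg
      (fun s y hs => by simp only [partialX_neg, partialT_neg, heat s y hs]) (by simp [h0])
      (by simp [partialX_neg, hx]) (by simpa [partialX_neg] using hxx)
      (by
        simp only [partialX_neg, Left.neg_pos_iff]
        exact lt_of_le_of_ne (not_lt.1 hpos) hxx)
    simpa using this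
  -- Near `(t, x)` one has `u t y ≥ 0` by the local minimum and `∂ₜu = ∂ₓₓu > 0` by continuity;
  -- hence `u s y > 0` for `s > t`. The neighbourhood must be a product, so that the segment from
  -- `(t, y)` to `(s, y)` stays inside.
  have hmin : IsLocalMin (fun z => u t z) x :=
    isLocalMin_of_deriv_deriv_pos (f := fun z => u t z) hpos hx
      (hu.hasDerivAt_partialX ht).continuousAt
  have hT : ∀ᶠ p in 𝓝 (t, x), 0 < p.1 ∧ 0 < partialT u p.1 p.2 := by
    refine (continuousAt_fst.eventually (lt_mem_nhds ht)).and ?_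
    refine (hu.partialT.continuousAt ht (x := x)).eventually (lt_mem_nhds ?_)
    simpa [heat t x ht] using hpos
  rw [nhds_prod_eq, eventually_prod_iff] at hT
  obtain ⟨pa, hpa, pb, hpb, hab⟩ := hT
  obtain ⟨δ, hδ, hball⟩ := Metric.eventually_nhds_iff_ball.1 hpa
  rw [nhds_prod_eq]
  refine (((Metric.eventually_nhds_iff_ball.2 ⟨δ, hδ, fun _ h => h⟩) :
    ∀ᶠ s in 𝓝 t, s ∈ Metric.ball t δ).prod_mk (hpb.and hmin)).mono ?_
  rintro ⟨s, y⟩ ⟨hs, hy, hy'⟩ hz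
  by_contra! hlt
  simp only at hs hy hy' hz hlt
  rw [h0] at hy'
  have hpos' : ∀ σ ∈ Icc t s, 0 < σ ∧ 0 < partialT u σ y := fun σ hσ => by
    refine hab (hball σ ?_) hy
    rw [Metric.mem_ball, Real.dist_eq] at hs ⊢
    rw [abs_of_nonneg (by linarith [hσ.1])]
    have := (abs_lt.1 hs).2
    linarith [hσ.2]
  have hmono : StrictMonoOn (fun σ => u σ y) (Icc t s) := by
    refine strictMonoOn_of_deriv_pos (convex_Icc t s) ?_ ?_
    · exact fun σ hσ => (hu.hasDerivAt_partialT (hpos' σ hσ).1).continuousAt.continuousWithinAt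
    · rw [interior_Icc]
      exact fun σ hσ => (hpos' σ (Ioo_subset_Icc_self hσ)).2
  have := hmono (left_mem_Icc.2 hlt.le) (right_mem_Icc.2 hlt.le) hlt
  simp only at this
  linarith

end RandomHeat

/-! ### The deterministic hypotheses, and local theory of curves of stable zeros. -/

namespace RandomHeat

open Filter Topology
open scoped ContDiff

/-- A smooth solution `V` of the heat equation and its velocity field `u = -∂ₓ V`, such that
`u` has no triple zeros, `V` has nowhere constant initial values and `V` stays above (below) any
given level, up to a given time, at points that are arbitrarily far on both sides. -/
structure BarrierPair (V u : ℝ → ℝ → ℝ) : Prop where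
  smooth_potential : SmoothField V
  smooth : SmoothField u
  hasDerivAt_space : ∀ t x, 0 < t → HasDerivAt (fun z => V t z) (-u t x) x
  hasDerivAt_time : ∀ t x, 0 < t → HasDerivAt (fun s => V s x) (-partialX u t x) t
  heat : ∀ t x, 0 < t → partialT u t x = partialX (partialX u) t x
  nondegenerate : ∀ t x, 0 < t → u t x = 0 → partialX u t x = 0 → partialX (partialX u) t x ≠ 0
  initial : ∀ a b, a < b → ∃ p ∈ Ioo a b, ∃ q ∈ Ioo a b, ∃ v w, v ≠ w ∧
    Tendsto (fun s => V s p) (𝓝[>] 0) (𝓝 v) ∧ Tendsto (fun s => V s q) (𝓝[>] 0) (𝓝 w)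
  above_right : ∀ T c x, ∃ M > x, ∀ s ∈ Ioc 0 T, c < V s M
  above_left : ∀ T c x, ∃ M < x, ∀ s ∈ Ioc 0 T, c < V s M
  below_right : ∀ T c x, ∃ M > x, ∀ s ∈ Ioc 0 T, V s M < c
  below_left : ∀ T c x, ∃ M < x, ∀ s ∈ Ioc 0 T, V s M < c

namespace BarrierPair

variable {V u : ℝ → ℝ → ℝ}

lemma neg (h : BarrierPair V u) : BarrierPair (fun t x => -V t x) (fun t x => -u t x) where
  smooth_potential := h.smooth_potential.neg
  smooth := h.smooth.neg
  hasDerivAt_space t x ht := (h.hasDerivAt_space t x ht).neg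
  hasDerivAt_time t x ht := by
    simpa [partialX_neg] using! (h.hasDerivAt_time t x ht).neg
  heat t x ht := by simp only [partialX_neg, partialT_neg, h.heat t x ht]
  nondegenerate t x ht := by simpa [partialX_neg] using h.nondegenerate t x ht
  initial a b hab := by
    obtain ⟨p, hp, q, hq, v, w, hvw, hv, hw⟩ := h.initial a b hab
    exact ⟨p, hp, q, hq, -v, -w, by simpa using hvw, hv.neg, hw.neg⟩
  above_right T c x := by
    obtain ⟨M, hM, hs⟩ := h.below_right T (-c) x
    exact ⟨M, hM, fun s h => by linarith [hs s h]⟩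
  above_left T c x := by
    obtain ⟨M, hM, hs⟩ := h.below_left T (-c) x
    exact ⟨M, hM, fun s h => by linarith [hs s h]⟩
  below_right T c x := by
    obtain ⟨M, hM, hs⟩ := h.above_right T (-c) x
    exact ⟨M, hM, fun s h => by linarith [hs s h]⟩
  below_left T c x := by
    obtain ⟨M, hM, hs⟩ := h.above_left T (-c) x
    exact ⟨M, hM, fun s h => by linarith [hs s h]⟩

/-- The values of `V` are nowhere constant in space as time decreases to `s`. -/
lemma exists_limits_ne (h : BarrierPair V u) {s : ℝ} (hs : 0 ≤ s) {a b : ℝ} (hab : a < b) :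
    ∃ p ∈ Ioo a b, ∃ q ∈ Ioo a b, ∃ v w, v < w ∧
      Tendsto (fun σ => V σ p) (𝓝[>] s) (𝓝 v) ∧ Tendsto (fun σ => V σ q) (𝓝[>] s) (𝓝 w) := by
  suffices ∃ p ∈ Ioo a b, ∃ q ∈ Ioo a b, ∃ v w, v ≠ w ∧
      Tendsto (fun σ => V σ p) (𝓝[>] s) (𝓝 v) ∧ Tendsto (fun σ => V σ q) (𝓝[>] s) (𝓝 w) by
    obtain ⟨p, hp, q, hq, v, w, hvw, hv, hw⟩ := this
    rcases hvw.lt_or_gt with hlt | hlt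
    · exact ⟨p, hp, q, hq, v, w, hlt, hv, hw⟩
    · exact ⟨q, hq, p, hp, w, v, hlt, hw, hv⟩
  rcases hs.eq_or_lt with rfl | hs
  · exact h.initial a b hab
  have hlim : ∀ y, Tendsto (fun σ => V σ y) (𝓝[>] s) (𝓝 (V s y)) := fun y =>
    ((h.hasDerivAt_time s y hs).continuousAt.tendsto).mono_left nhdsWithin_le_nhds
  suffices ∃ p ∈ Ioo a b, ∃ q ∈ Ioo a b, V s p ≠ V s q by
    obtain ⟨p, hp, q, hq, hpq⟩ := this
    exact ⟨p, hp, q, hq, _, _, hpq, hlim p, hlim q⟩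
  -- At a positive time, constancy of `V s` on an interval makes `u`, `u_x` and `u_xx` vanish there:
  -- a triple zero.
  by_contra! hconst
  have zero_of_const : ∀ (f g : ℝ → ℝ) (c : ℝ), (∀ y, HasDerivAt f (g y) y) →
      (∀ y ∈ Ioo a b, f y = c) → ∀ y ∈ Ioo a b, g y = 0 := fun f g c hd hc y hy =>
    (hd y).unique ((hasDerivAt_const y c).congr_of_eventuallyEq
      (eventually_of_mem (Ioo_mem_nhds hy.1 hy.2) fun z hz => hc z hz))
  obtain ⟨m, hm⟩ := nonempty_Ioo.2 hab
  have h0 : ∀ y ∈ Ioo a b, u s y = 0 := fun y hy => by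
    simpa using zero_of_const _ _ (V s m) (fun y => h.hasDerivAt_space s y hs)
      (fun y hy => hconst y hy m hm) y hy
  have h1 := zero_of_const _ _ 0 (fun y => h.smooth.hasDerivAt_partialX hs) h0
  have h2 := zero_of_const _ _ 0 (fun y => h.smooth.partialX.hasDerivAt_partialX hs) h1
  exact h.nondegenerate s m hs (h0 m hm) (h1 m hm) (h2 m hm)

end BarrierPair

/-- The coincidence set is closed by continuity and open because both curves coincide with the
implicit function near a common point; connectedness concludes. Simplicity of the zeros is needed
along `r` only. -/
lemma eqOn_of_nondegenerate_zero {u : ℝ → ℝ → ℝ} (hu : SmoothField u) {I : Set ℝ}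
    (hI : IsPreconnected I) (hpos : ∀ s ∈ I, 0 < s) {r r' : ℝ → ℝ} (hr : ContinuousOn r I)
    (hr' : ContinuousOn r' I) (hz : ∀ s ∈ I, u s (r s) = 0) (hz' : ∀ s ∈ I, u s (r' s) = 0)
    (hnd : ∀ s ∈ I, partialX u s (r s) ≠ 0) {t : ℝ} (ht : t ∈ I) (h : r' t = r t) :
    EqOn r' r I := by
  have : PreconnectedSpace I := isPreconnected_iff_preconnectedSpace.1 hI
  have hclopen : IsClopen {s : I | r' s = r s} := by
    refine ⟨isClosed_eq hr'.domRestrict hr.domRestrict, isOpen_iff_mem_nhds.2 fun s hs => ?_⟩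
    obtain ⟨φ, -, -, -, hφ⟩ := exists_local_zero_curve hu (hpos s s.2) (hz s s.2) (hnd s s.2)
    have key : ∀ ρ : ℝ → ℝ, ContinuousOn ρ I → ρ s = r s → (∀ s ∈ I, u s (ρ s) = 0) →
        ∀ᶠ σ : I in 𝓝 s, ρ σ = φ σ := fun ρ hρ hs hz => by
      have ht : Tendsto (fun σ : I => ((σ : ℝ), ρ σ)) (𝓝 s) (𝓝 ((s : ℝ), r s)) := by
        rw [← hs]
        exact (continuous_subtype_val.prodMk hρ.domRestrict).tendsto s
      filter_upwards [ht.eventually hφ] with σ hσ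
      exact hσ.1 (hz σ σ.2)
    filter_upwards [key r hr rfl hz, key r' hr' hs hz'] with σ h1 h2
    exact h2.trans h1.symm
  have huniv := hclopen.eq_univ ⟨⟨t, ht⟩, h⟩
  intro s hs
  have : (⟨s, hs⟩ : I) ∈ {s : I | r' s = r s} := huniv ▸ mem_univ _
  exact this

/-- The zero set near a stable zero is the graph of a continuous curve of stable zeros. -/
lemma exists_stable_germ {u : ℝ → ℝ → ℝ} (hu : SmoothField u) {s y : ℝ} (hs : 0 < s)
    (hys : y ∈ stableZeros u s) :
    ∃ φ : ℝ → ℝ, φ s = y ∧ (∀ᶠ σ in 𝓝 s, φ σ ∈ stableZeros u σ ∧ ContinuousAt φ σ) ∧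
      ∀ᶠ p in 𝓝 (s, y), u p.1 p.2 = 0 ↔ p.2 = φ p.1 := by
  obtain ⟨φ, h1, h2, h3, h4⟩ := exists_local_zero_curve hu hs hys.1 hys.2.ne
  have hφ : ContinuousAt φ s := h2.continuousAt
  have hpair : Tendsto (fun σ => (σ, φ σ)) (𝓝 s) (𝓝 (s, y)) := by
    have := (continuousAt_id (x := s)).prodMk hφ
    simpa [ContinuousAt, h1] using this
  have hneg : ∀ᶠ σ in 𝓝 s, φ σ ∈ stableZeros u σ := by
    filter_upwards [hpair.eventually h4, hpair.eventually
      ((hu.partialX.continuousAt hs (x := y)).eventually (gt_mem_nhds hys.2))] with σ h5 h6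
    exact ⟨h5.2 rfl, h6⟩
  have hcd : ∀ᶠ σ in 𝓝 s, ContinuousAt φ σ :=
    ((h2.of_le (m := 1) (by simp)).eventually (by simp)).mono fun _ h => h.continuousAt
  exact ⟨φ, h1, hneg.and hcd, h4⟩

/-- `r` is a continuous curve of stable zeros on `(s, t]` that ends at `x`. -/
structure IsStableCurve (u : ℝ → ℝ → ℝ) (s t x : ℝ) (r : ℝ → ℝ) : Prop where
  continuousOn : ContinuousOn r (Ioc s t)
  endpoint : r t = x
  stable : ∀ σ ∈ Ioc s t, r σ ∈ stableZeros u σ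

namespace IsStableCurve

variable {u : ℝ → ℝ → ℝ} {s t x : ℝ} {r : ℝ → ℝ}

lemma mono (h : IsStableCurve u s t x r) {s' : ℝ} (hs : s ≤ s') : IsStableCurve u s' t x r :=
  ⟨h.continuousOn.mono (Ioc_subset_Ioc_left hs), h.endpoint,
    fun σ hσ => h.stable σ (Ioc_subset_Ioc_left hs hσ)⟩

lemma eqOn (hu : SmoothField u) (hs : 0 ≤ s) (hst : s < t) (h : IsStableCurve u s t x r)
    {r' : ℝ → ℝ} (hr' : ContinuousOn r' (Ioc s t)) (hx : r' t = x)
    (hz : ∀ σ ∈ Ioc s t, u σ (r' σ) = 0) : EqOn r' r (Ioc s t) :=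
  eqOn_of_nondegenerate_zero hu isPreconnected_Ioc (fun _ hσ => hs.trans_lt hσ.1)
    h.continuousOn hr' (fun σ hσ => (h.stable σ hσ).1) hz (fun σ hσ => (h.stable σ hσ).2.ne)
    (right_mem_Ioc.2 hst) (hx.trans h.endpoint.symm)

/-- A stable curve is locally the implicit function. -/
lemma exists_smooth (hu : SmoothField u) (hs : 0 ≤ s) (h : IsStableCurve u s t x r) {σ : ℝ}
    (hσ : σ ∈ Ioc s t) :
    ∃ φ : ℝ → ℝ, φ σ = r σ ∧ ContDiffAt ℝ ∞ φ σ ∧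
      HasDerivAt φ (-(partialT u σ (r σ) / partialX u σ (r σ))) σ ∧ r =ᶠ[𝓝[Ioc s t] σ] φ := by
  obtain ⟨φ, h1, h2, h3, h4⟩ := exists_local_zero_curve hu (hs.trans_lt hσ.1) (h.stable σ hσ).1
    (h.stable σ hσ).2.ne
  refine ⟨φ, h1, h2, h3, ?_⟩
  have ht : Tendsto (fun τ => (τ, r τ)) (𝓝[Ioc s t] σ) (𝓝 (σ, r σ)) :=
    (tendsto_id.mono_left nhdsWithin_le_nhds).prodMk_nhds (h.continuousOn σ hσ)
  filter_upwards [ht.eventually h4, self_mem_nhdsWithin] with τ hτ hτ'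
  exact hτ.1 (h.stable τ hτ').1

lemma hasDerivWithinAt (hu : SmoothField u) (hs : 0 ≤ s) (h : IsStableCurve u s t x r) {σ : ℝ}
    (hσ : σ ∈ Ioc s t) :
    HasDerivWithinAt r (-(partialT u σ (r σ) / partialX u σ (r σ))) (Ioc s t) σ := by
  obtain ⟨φ, h1, -, h3, h4⟩ := h.exists_smooth hu hs hσ
  exact h3.hasDerivWithinAt.congr_of_eventuallyEq h4 h1.symm

lemma contDiffAt (hu : SmoothField u) (hs : 0 ≤ s) (h : IsStableCurve u s t x r) {σ : ℝ}
    (hσ : σ ∈ Ioo s t) : ContDiffAt ℝ ∞ r σ := by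
  obtain ⟨φ, -, h2, -, h4⟩ := h.exists_smooth hu hs (Ioo_subset_Ioc_self hσ)
  rw [nhdsWithin_eq_nhds.2 (Ioc_mem_nhds hσ.1 hσ.2)] at h4
  exact h2.congr_of_eventuallyEq h4

/-- A stable curve can be prolonged through a stable limit point. -/
lemma extend (hu : SmoothField u) (hs : 0 < s) (hst : s < t) (h : IsStableCurve u s t x r)
    {y : ℝ} (hy : Tendsto r (𝓝[>] s) (𝓝 y)) (hys : y ∈ stableZeros u s) :
    ∃ s' ∈ Ico 0 s, ∃ r', IsStableCurve u s' t x r' := by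
  obtain ⟨φ, -, hφ, h4⟩ := exists_stable_germ hu hs hys
  have hr : ∀ᶠ σ in 𝓝[>] s, r σ = φ σ := by
    have ht : Tendsto (fun τ => (τ, r τ)) (𝓝[>] s) (𝓝 (s, y)) :=
      (tendsto_id.mono_left nhdsWithin_le_nhds).prodMk_nhds hy
    filter_upwards [ht.eventually h4, Ioc_mem_nhdsGT hst] with τ hτ hτ'
    exact hτ.1 (h.stable τ hτ').1
  obtain ⟨δ, hδ, hball⟩ := Metric.eventually_nhds_iff.1 hφ
  obtain ⟨e, he, hre⟩ := mem_nhdsGT_iff_exists_Ioo_subset.1 hr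
  -- This start keeps `(s', s]` inside the ball where `φ` is a continuous curve of stable zeros, and
  -- keeps `s'` nonnegative.
  refine ⟨max 0 (s - δ / 2), ⟨le_max_left _ _, max_lt hs (by linarith)⟩,
    fun σ => if σ ≤ s then φ σ else r σ, ?_, ?_, ?_⟩
  · intro σ hσ
    rcases le_or_gt σ s with hle | hlt
    · have hc : ContinuousAt φ σ := by
        refine (hball ?_).2
        rw [Real.dist_eq, abs_sub_comm, abs_of_nonneg (by linarith)]
        linarith [(le_max_right 0 (s - δ / 2)).trans_lt hσ.1]
      refine ContinuousAt.continuousWithinAt (hc.congr ?_)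
      -- The junction at `s` is harmless: `r = φ` on `(s, e)`, so the glued curve equals `φ` on all
      -- of `(-∞, e)`.
      filter_upwards [gt_mem_nhds (hle.trans_lt he)] with τ hτ
      split_ifs with h5
      · rfl
      · exact (hre ⟨not_le.1 h5, hτ⟩).symm
    · have hc : ContinuousWithinAt r (Ioc (max 0 (s - δ / 2)) t) σ :=
        (h.continuousOn σ ⟨hlt, hσ.2⟩).mono_of_mem_nhdsWithin
          (mem_of_superset (inter_mem_nhdsWithin _ (lt_mem_nhds hlt)) fun τ hτ => ⟨hτ.2, hτ.1.2⟩)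
      refine hc.congr_of_eventuallyEq ?_ (if_neg hlt.not_ge)
      filter_upwards [mem_nhdsWithin_of_mem_nhds (lt_mem_nhds hlt)] with τ hτ
      exact if_neg (not_le.2 hτ)
  · simp only [if_neg hst.not_ge, h.endpoint]
  · intro σ hσ
    split_ifs with hle
    · refine (hball ?_).1
      rw [Real.dist_eq, abs_sub_comm, abs_of_nonneg (by linarith)]
      linarith [(le_max_right 0 (s - δ / 2)).trans_lt hσ.1]
    · exact h.stable σ ⟨not_le.1 hle, hσ.2⟩

end IsStableCurve

end RandomHeat

/-! ### Backward continuation of stable zeros, with the potential as a Lyapunov function. -/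

namespace RandomHeat

open Filter Topology
open scoped ContDiff

namespace IsStableCurve

variable {V u : ℝ → ℝ → ℝ} {s t x : ℝ} {r : ℝ → ℝ}

/-- The potential increases with time along a curve of stable zeros. -/
lemma monotoneOn_potential (hV : BarrierPair V u) (hs : 0 ≤ s) (h : IsStableCurve u s t x r) :
    MonotoneOn (fun σ => V σ (r σ)) (Ioc s t) := by
  refine monotoneOn_of_deriv_nonneg (convex_Ioc s t) ?_ ?_ ?_
  · intro σ hσ
    have h1 := hV.smooth_potential.continuousAt (hs.trans_lt hσ.1) (x := r σ)
    exact ContinuousAt.comp_continuousWithinAt (f := fun σ => (σ, r σ)) h1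
      (continuousWithinAt_id.prodMk (h.continuousOn σ hσ))
  all_goals
    rw [interior_Ioc]
    intro σ hσ
    have hpos := hs.trans_lt hσ.1
    -- In `dV/dσ = V_t + V_x r'` the last term vanishes, since `V_x = -u = 0` on the curve, and `V_t
    -- = -u_x > 0` by stability.
    have hd := hV.smooth_potential.hasDerivAt_comp hpos
      ((h.contDiffAt hV.smooth hs hσ).differentiableAt (by simp)).hasDerivAt
    have hx : partialX V σ (r σ) = 0 := by
      rw [partialX, (hV.hasDerivAt_space σ (r σ) hpos).deriv,
        (h.stable σ (Ioo_subset_Ioc_self hσ)).1, neg_zero]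
    have ht : partialT V σ (r σ) = -partialX u σ (r σ) :=
      (hV.hasDerivAt_time σ (r σ) hpos).deriv
    rw [hx, zero_mul, add_zero, ht] at hd
  · exact hd.differentiableAt.differentiableWithinAt
  · rw [hd.deriv]
    have := (h.stable σ (Ioo_subset_Ioc_self hσ)).2
    linarith

/-- By monotonicity the potential along the curve never exceeds `V t x`, whereas at `a` and `b` it
is above this level throughout `(0, t]`; by the intermediate value theorem the curve cannot get past
them. -/
lemma bounded (hV : BarrierPair V u) (hs : 0 ≤ s) (hst : s < t) (h : IsStableCurve u s t x r) :
    ∃ a b, ∀ σ ∈ Ioc s t, r σ ∈ Icc a b := by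
  obtain ⟨a, ha, hVa⟩ := hV.above_left t (V t x) x
  obtain ⟨b, hb, hVb⟩ := hV.above_right t (V t x) x
  have hle : ∀ σ ∈ Ioc s t, V σ (r σ) ≤ V t x := fun σ hσ => by
    have := h.monotoneOn_potential hV hs hσ (right_mem_Ioc.2 hst) hσ.2
    simpa [h.endpoint] using this
  have hne : ∀ σ ∈ Ioc s t, r σ ≠ a ∧ r σ ≠ b := fun σ hσ => by
    constructor <;> intro heq
    · exact (hVa σ ⟨hs.trans_lt hσ.1, hσ.2⟩).not_ge (heq ▸ hle σ hσ)
    · exact (hVb σ ⟨hs.trans_lt hσ.1, hσ.2⟩).not_ge (heq ▸ hle σ hσ)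
  have hsub : ∀ σ ∈ Ioc s t, uIcc σ t ⊆ Ioc s t := fun σ hσ => by
    rw [uIcc_of_le hσ.2]
    exact fun τ hτ => ⟨hσ.1.trans_le hτ.1, hτ.2⟩
  refine ⟨a, b, fun σ hσ => ⟨?_, ?_⟩⟩
  · by_contra! hlt
    have hm : a ∈ uIcc (r σ) (r t) := by
      rw [h.endpoint, mem_uIcc]; exact .inl ⟨hlt.le, ha.le⟩
    obtain ⟨τ, hτ, hτa⟩ := intermediate_value_uIcc (h.continuousOn.mono (hsub σ hσ)) hm
    exact (hne τ (hsub σ hσ hτ)).1 hτa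
  · by_contra! hlt
    have hm : b ∈ uIcc (r σ) (r t) := by
      rw [h.endpoint, mem_uIcc]; exact .inr ⟨hb.le, hlt.le⟩
    obtain ⟨τ, hτ, hτa⟩ := intermediate_value_uIcc (h.continuousOn.mono (hsub σ hσ)) hm
    exact (hne τ (hsub σ hσ hτ)).2 hτa

/-- A bounded curve without a limit oscillates across some `(a, b)` as time decreases to `s`. Pick
`p`, `q` there with limits `v < m < w` of `V`. The curve visits `p` at some `σ₁` with `V < m`, and
`q` at a time `σ₂ < σ₁` with `V > m`, against monotonicity. -/
lemma exists_limit (hV : BarrierPair V u) (hs : 0 ≤ s) (hst : s < t)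
    (h : IsStableCurve u s t x r) : ∃ y, Tendsto r (𝓝[>] s) (𝓝 y) := by
  obtain ⟨A, B, hAB⟩ := h.bounded hV hs hst
  have hmem : ∀ᶠ σ in 𝓝[>] s, σ ∈ Ioc s t := Ioc_mem_nhdsGT hst
  refine tendsto_of_no_upcrossings dense_univ ?_ ⟨B, ?_⟩ ⟨A, ?_⟩
  rotate_left
  · exact eventually_map.2 (hmem.mono fun σ hσ => (hAB σ hσ).2)
  · exact eventually_map.2 (hmem.mono fun σ hσ => (hAB σ hσ).1)
  rintro a - b - hab ⟨hfa, hfb⟩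
  -- every intermediate value is taken at arbitrarily small times
  have hval : ∀ y ∈ Ioo a b, ∃ᶠ σ in 𝓝[>] s, r σ = y := by
    intro y hy
    rw [(nhdsGT_basis s).frequently_iff]
    intro e he
    have hI : ∀ᶠ σ in 𝓝[>] s, σ ∈ Ioo s (min e t) := Ioo_mem_nhdsGT (lt_min he hst)
    obtain ⟨σ₁, h1, h1'⟩ := (hfa.and_eventually hI).exists
    obtain ⟨σ₂, h2, h2'⟩ := (hfb.and_eventually hI).exists
    have hsub : uIcc σ₁ σ₂ ⊆ Ioo s (min e t) := ordConnected_Ioo.uIcc_subset h1' h2'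
    have hm : y ∈ uIcc (r σ₁) (r σ₂) := mem_uIcc.2 (.inl ⟨(h1.trans hy.1).le, (hy.2.trans h2).le⟩)
    obtain ⟨τ, hτ, hτy⟩ := intermediate_value_uIcc (h.continuousOn.mono
      (hsub.trans fun σ hσ => ⟨hσ.1, hσ.2.le.trans (min_le_right _ _)⟩)) hm
    exact ⟨τ, ⟨(hsub hτ).1, (hsub hτ).2.trans_le (min_le_left _ _)⟩, hτy⟩
  obtain ⟨p, hp, q, hq, v, w, hvw, hv, hw⟩ := hV.exists_limits_ne hs hab
  obtain ⟨m, hvm, hmw⟩ := exists_between hvw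
  obtain ⟨σ₁, h1, h1', h1s⟩ := ((hval p hp).and_eventually
    ((hv.eventually (gt_mem_nhds hvm)).and hmem)).exists
  have hlt : ∀ᶠ σ in 𝓝[>] s, σ < σ₁ := mem_nhdsWithin_of_mem_nhds (gt_mem_nhds h1s.1)
  obtain ⟨σ₂, h2, h2', h2s, h2lt⟩ := ((hval q hq).and_eventually
    ((hw.eventually (lt_mem_nhds hmw)).and (hmem.and hlt))).exists
  have := h.monotoneOn_potential hV hs h2s h1s h2lt.le
  simp only [h1, h2] at this
  linarith

end IsStableCurve

/-- A stable zero can be traced back to time `0`. -/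
lemma BarrierPair.exists_isStableCurve {V u : ℝ → ℝ → ℝ} (hV : BarrierPair V u) {t x : ℝ}
    (ht : 0 < t) (hx : x ∈ stableZeros u t) : ∃ r, IsStableCurve u 0 t x r := by
  have hu := hV.smooth
  -- The infimum `s₀` of the possible starting times is itself attained, by gluing; `s₀ > 0` is then
  -- refuted.
  set S : Set ℝ := {s | s ∈ Ico 0 t ∧ ∃ r, IsStableCurve u s t x r} with hS
  have hne : S.Nonempty := by
    obtain ⟨φ, h1, h2, -⟩ := exists_stable_germ hu ht hx
    obtain ⟨δ, hδ, hball⟩ := Metric.eventually_nhds_iff.1 h2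
    have hnear : ∀ σ ∈ Ioc (max 0 (t - δ)) t, dist σ t < δ := fun σ hσ => by
      rw [Real.dist_eq, abs_sub_comm, abs_of_nonneg (by linarith [hσ.2])]
      linarith [(le_max_right 0 (t - δ)).trans_lt hσ.1]
    exact ⟨max 0 (t - δ), ⟨le_max_left _ _, max_lt ht (by linarith)⟩, φ,
      fun σ hσ => (hball (hnear σ hσ)).2.continuousWithinAt, h1,
      fun σ hσ => (hball (hnear σ hσ)).1⟩
  have hbdd : BddBelow S := ⟨0, fun s hs => hs.1.1⟩
  set s₀ := sInf S with hs₀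
  have hs₀0 : 0 ≤ s₀ := le_csInf hne fun s hs => hs.1.1
  have hs₀t : s₀ < t := by
    obtain ⟨s, hs⟩ := hne
    exact (csInf_le hbdd hs).trans_lt hs.1.2
  -- For each `σ > s₀` one curve `ρ σ` starting before `σ` is chosen. These agree on overlaps by
  -- uniqueness, so the diagonal `σ ↦ ρ σ σ` is one curve on `(s₀, t]`.
  have hex : ∀ σ, s₀ < σ → ∃ s, ∃ r, s < σ ∧ s ∈ Ico 0 t ∧ IsStableCurve u s t x r := fun σ hσ => by
    obtain ⟨s, hs, hlt⟩ := exists_lt_of_csInf_lt hne hσ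
    exact ⟨s, hs.2.choose, hlt, hs.1, hs.2.choose_spec⟩
  choose! τ ρ hτ hτI hρ using hex
  have hglue : ∀ σ ∈ Ioc s₀ t, ∀ σ' ∈ Ioc (τ σ) t, s₀ < σ' → ρ σ' σ' = ρ σ σ' := by
    intro σ hσ σ' hσ' h0
    have hlt : max (τ σ') (τ σ) < σ' := max_lt (hτ σ' h0) hσ'.1
    exact ((hρ σ hσ.1).mono (le_max_right _ _)).eqOn hu
      ((hτI σ hσ.1).1.trans (le_max_right _ _)) (hlt.trans_le hσ'.2)
      ((hρ σ' h0).continuousOn.mono (Ioc_subset_Ioc_left (le_max_left _ _))) (hρ σ' h0).endpoint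
      (fun z hz => ((hρ σ' h0).stable z (Ioc_subset_Ioc_left (le_max_left _ _) hz)).1)
      ⟨hlt, hσ'.2⟩
  have hR : IsStableCurve u s₀ t x fun σ => ρ σ σ := by
    refine ⟨fun σ hσ => ?_, (hρ t hs₀t).endpoint, fun σ hσ =>
      (hρ σ hσ.1).stable σ ⟨hτ σ hσ.1, hσ.2⟩⟩
    have hc : ContinuousWithinAt (ρ σ) (Ioc s₀ t) σ :=
      ((hρ σ hσ.1).continuousOn σ ⟨hτ σ hσ.1, hσ.2⟩).mono_of_mem_nhdsWithin
        (mem_of_superset (inter_mem_nhdsWithin _ (lt_mem_nhds (hτ σ hσ.1)))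
          fun z hz => ⟨hz.2, hz.1.2⟩)
    refine hc.congr_of_eventuallyEq ?_ rfl
    filter_upwards [inter_mem_nhdsWithin _ (lt_mem_nhds (hτ σ hσ.1))] with z hz
    exact hglue σ hσ z ⟨hz.2, hz.1.2⟩ hz.1.1
  rcases hs₀0.eq_or_lt with h0 | hpos
  · exact ⟨_, h0 ▸ hR⟩
  exfalso
  obtain ⟨y, hy⟩ := hR.exists_limit hV hs₀0 hs₀t
  have hpair : Tendsto (fun σ => (σ, ρ σ σ)) (𝓝[>] s₀) (𝓝 (s₀, y)) :=
    (tendsto_id.mono_left nhdsWithin_le_nhds).prodMk_nhds hy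
  have hmem : ∀ᶠ σ in 𝓝[>] s₀, σ ∈ Ioc s₀ t := Ioc_mem_nhdsGT hs₀t
  have hz : u s₀ y = 0 := by
    refine tendsto_nhds_unique_of_eventuallyEq
      ((hu.continuousAt hpos (x := y)).tendsto.comp hpair) tendsto_const_nhds ?_
    filter_upwards [hmem] with σ hσ using (hR.stable σ hσ).1
  have hle : partialX u s₀ y ≤ 0 := by
    refine le_of_tendsto ((hu.partialX.continuousAt hpos (x := y)).tendsto.comp hpair) ?_
    filter_upwards [hmem] with σ hσ using (hR.stable σ hσ).2.le
  rcases hle.eq_or_lt with heq | hlt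
  -- A double zero cannot be the limit: all zeros near it have times at most `s₀`, but the curve
  -- approaches it at later times.
  · have hev := eventually_le_of_double_zero hu hV.heat hpos hz heq
      (hV.nondegenerate s₀ y hpos hz heq)
    obtain ⟨σ, h1, h2⟩ := ((hpair.eventually hev).and hmem).exists
    exact (h1 (hR.stable σ h2).1).not_gt h2.1
  · obtain ⟨s', hs', r', hr'⟩ := hR.extend hu hpos hs₀t hy ⟨hz, hlt⟩
    exact (csInf_le hbdd ⟨⟨hs'.1, hs'.2.trans hs₀t⟩, r', hr'⟩).not_gt hs'.2

end RandomHeat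

/-! ### The deterministic form of the theorem. -/

namespace RandomHeat

open Filter Topology
open scoped ContDiff

lemma isZeroCurve_neg {u : ℝ → ℝ → ℝ} {t x : ℝ} {r : ℝ → ℝ} :
    IsZeroCurve (fun t x => -u t x) t x r ↔ IsZeroCurve u t x r :=
  ⟨fun h => ⟨h.1, h.2, fun s hs => neg_eq_zero.1 (h.3 s hs)⟩,
    fun h => ⟨h.1, h.2, fun s hs => neg_eq_zero.2 (h.3 s hs)⟩⟩

lemma stableZeros_neg (u : ℝ → ℝ → ℝ) (t : ℝ) :
    stableZeros (fun t x => -u t x) t = unstableZeros u t := by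
  ext x; simp [stableZeros, unstableZeros, partialX_neg]

namespace BarrierPair

variable {V u : ℝ → ℝ → ℝ}

/-- At time `0` the curve is given its limit as value. No equation holds there, so uniqueness at `0`
comes from continuity alone. -/
lemma exists_zeroCurve_of_stable (hV : BarrierPair V u) {t x : ℝ} (ht : 0 < t)
    (hx : x ∈ stableZeros u t) :
    ∃ r : ℝ → ℝ, IsZeroCurve u t x r ∧
      (∀ r' : ℝ → ℝ, IsZeroCurve u t x r' → EqOn r' r (Icc 0 t)) ∧
      (∀ s ∈ Ioc 0 t, r s ∈ stableZeros u s) ∧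
      ContDiffOn ℝ ∞ r (Ioo 0 t) ∧
      ∀ s ∈ Ioc 0 t,
        HasDerivWithinAt r (-(partialT u s (r s) / partialX u s (r s))) (Icc 0 t) s := by
  obtain ⟨ρ, hρ⟩ := hV.exists_isStableCurve ht hx
  obtain ⟨y, hy⟩ := hρ.exists_limit hV le_rfl ht
  have heq : ∀ s ∈ Ioc 0 t, Function.update ρ 0 y s = ρ s := fun s hs =>
    Function.update_of_ne hs.1.ne' _ _
  have hρ' : IsStableCurve u 0 t x (Function.update ρ 0 y) :=
    ⟨hρ.continuousOn.congr heq, (heq t (right_mem_Ioc.2 ht)).trans hρ.endpoint,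
      fun s hs => by rw [heq s hs]; exact hρ.stable s hs⟩
  have hy' : Tendsto (Function.update ρ 0 y) (𝓝[>] 0) (𝓝 (Function.update ρ 0 y 0)) := by
    rw [Function.update_self]
    exact hy.congr' (eventually_of_mem self_mem_nhdsWithin
      fun s hs => (Function.update_of_ne (ne_of_gt hs) _ _).symm)
  generalize Function.update ρ 0 y = r at hρ' hy'
  have hnhds : ∀ s ∈ Ioc 0 t, Ioc 0 t ∈ 𝓝[Icc 0 t] s := fun s hs =>
    mem_of_superset (inter_mem_nhdsWithin _ (lt_mem_nhds hs.1)) fun z hz => ⟨hz.2, hz.1.2⟩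
  have hsplit : ∀ s ∈ Icc 0 t, s = 0 ∨ s ∈ Ioc 0 t := fun s hs =>
    hs.1.eq_or_lt.imp Eq.symm fun h => ⟨h, hs.2⟩
  refine ⟨r, ⟨fun s hs => ?_, hρ'.endpoint, fun s hs => (hρ'.stable s hs).1⟩, fun r' hr' => ?_,
    hρ'.stable, fun s hs => (hρ'.contDiffAt hV.smooth le_rfl hs).contDiffWithinAt, fun s hs =>
      (hρ'.hasDerivWithinAt hV.smooth le_rfl hs).mono_of_mem_nhdsWithin (hnhds s hs)⟩
  · rcases hsplit s hs with rfl | hs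
    · refine continuousWithinAt_Icc_iff_Ici ht |>.2 ?_
      exact continuousWithinAt_Ioi_iff_Ici.1 hy'
    · exact (hρ'.continuousOn s hs).mono_of_mem_nhdsWithin (hnhds s hs)
  · have hE : EqOn r' r (Ioc 0 t) := hρ'.eqOn hV.smooth le_rfl ht
      (hr'.continuousOn.mono Ioc_subset_Icc_self) hr'.endpoint hr'.zero
    intro s hs
    rcases hsplit s hs with rfl | hs
    · have h1 : Tendsto r' (𝓝[>] 0) (𝓝 (r' 0)) := continuousWithinAt_Ioi_iff_Ici.2
        ((continuousWithinAt_Icc_iff_Ici ht).1 (hr'.continuousOn 0 hs))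
      exact tendsto_nhds_unique_of_eventuallyEq h1 hy'
        (eventually_of_mem (Ioc_mem_nhdsGT ht) hE)
    · exact hE hs

theorem exists_zeroCurve (hV : BarrierPair V u) {t x : ℝ} (ht : 0 < t)
    (hx : x ∈ stableZeros u t ∪ unstableZeros u t) :
    ∃ r : ℝ → ℝ, IsZeroCurve u t x r ∧
      (∀ r' : ℝ → ℝ, IsZeroCurve u t x r' → EqOn r' r (Icc 0 t)) ∧
      (x ∈ stableZeros u t → ∀ s ∈ Ioc 0 t, r s ∈ stableZeros u s) ∧
      (x ∈ unstableZeros u t → ∀ s ∈ Ioc 0 t, r s ∈ unstableZeros u s) ∧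
      ContDiffOn ℝ ∞ r (Ioo 0 t) ∧
      ∀ s ∈ Ioc 0 t,
        HasDerivWithinAt r (-(partialT u s (r s) / partialX u s (r s))) (Icc 0 t) s ∧
        -(partialT u s (r s) / partialX u s (r s)) =
          -(partialX (partialX u) s (r s) / partialX u s (r s)) := by
  rcases hx with hx | hx
  · obtain ⟨r, h1, h2, h3, h4, h5⟩ := hV.exists_zeroCurve_of_stable ht hx
    exact ⟨r, h1, h2, fun _ => h3, fun h => absurd hx.2 h.2.not_gt, h4,
      fun s hs => ⟨h5 s hs, by rw [hV.heat s _ hs.1]⟩⟩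
  -- The passage to `-V`, `-u` exchanges stable and unstable zeros and preserves the quotients of
  -- derivatives.
  · obtain ⟨r, h1, h2, h3, h4, h5⟩ := hV.neg.exists_zeroCurve_of_stable ht
      ((stableZeros_neg u t).symm ▸ hx)
    simp only [isZeroCurve_neg, stableZeros_neg, partialX_neg, partialT_neg, neg_div_neg_eq]
      at h1 h2 h3 h5
    exact ⟨r, h1, h2, fun h => absurd hx.2 h.2.not_gt, fun _ => h3, h4,
      fun s hs => ⟨h5 s hs, by rw [hV.heat s _ hs.1]⟩⟩

end BarrierPair

end RandomHeat

/-! ### Smoothness of Gaussian moments of a path. -/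

namespace RandomHeat

open Filter Topology
open scoped ContDiff

/-- `b` is integrable against all centred Gaussian densities. -/
def GaussIntegrable (b : ℝ → ℝ) : Prop :=
  ∀ a : ℝ, 0 < a → Integrable fun y => Real.exp (-a * y ^ 2) * b y

/-- The Gaussian moment `∫ (x - y) ^ n exp (-a (x - y)²) b(y) dy` at `p = (a, x)`. -/
noncomputable def moment (b : ℝ → ℝ) (n : ℕ) (p : ℝ × ℝ) : ℝ :=
  ∫ y, (p.2 - y) ^ n * Real.exp (-p.1 * (p.2 - y) ^ 2) * b y

/-- The derivative of `moment b n` with respect to the space variable. -/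
noncomputable def momentX (b : ℝ → ℝ) (n : ℕ) (p : ℝ × ℝ) : ℝ :=
  -- At `n = 0` the truncated index `n - 1` is harmless, because of the factor `n`.
  n * moment b (n - 1) p - 2 * p.1 * moment b (n + 1) p

lemma abs_pow_mul_exp_le (n : ℕ) {β : ℝ} (hβ : 0 < β) (z : ℝ) :
    |z| ^ n * Real.exp (-β * z ^ 2) ≤ 1 + n.factorial / β ^ n := by
  have h1 : |z| ^ n ≤ 1 + (z ^ 2) ^ n := by
    rw [← sq_abs, ← pow_mul, mul_comm 2, pow_mul]
    nlinarith [sq_nonneg (|z| ^ n - 1)]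
  have h2 : (β * z ^ 2) ^ n / n.factorial ≤ Real.exp (β * z ^ 2) :=
    Real.pow_div_factorial_le_exp _ (by positivity) n
  have h3 : (z ^ 2) ^ n ≤ n.factorial / β ^ n * Real.exp (β * z ^ 2) := by
    rw [div_le_iff₀ (by positivity), mul_pow] at h2
    rw [div_mul_eq_mul_div, le_div_iff₀ (by positivity)]
    linarith
  have h4 : Real.exp (-β * z ^ 2) * Real.exp (β * z ^ 2) = 1 := by
    rw [← Real.exp_add]; simp
  have h5 : Real.exp (-β * z ^ 2) ≤ 1 := Real.exp_le_one_iff.2 (by nlinarith [sq_nonneg z])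
  calc |z| ^ n * Real.exp (-β * z ^ 2)
      ≤ (1 + n.factorial / β ^ n * Real.exp (β * z ^ 2)) * Real.exp (-β * z ^ 2) := by
        gcongr; linarith
    _ = Real.exp (-β * z ^ 2)
        + n.factorial / β ^ n * (Real.exp (-β * z ^ 2) * Real.exp (β * z ^ 2)) := by ring
    _ ≤ 1 + n.factorial / β ^ n := by rw [h4]; linarith

/-- Half of the exponent absorbs the power; the other half is recentred at `0` through `(x - y)² ≥
y² / 2 - x²`, that is, `(2x - y)² ≥ 0`. The bound is locally uniform in `(a, x)`, as differentiation
under the integral requires. -/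
lemma exists_gaussian_bound (n : ℕ) {α : ℝ} (hα : 0 < α) (R : ℝ) :
    ∃ C, 0 ≤ C ∧ ∀ a x y, α ≤ a → |x| ≤ R →
      |(x - y) ^ n * Real.exp (-a * (x - y) ^ 2)| ≤ C * Real.exp (-(α / 4) * y ^ 2) := by
  refine ⟨(1 + n.factorial / (α / 2) ^ n) * Real.exp (α / 2 * R ^ 2), by positivity,
    fun a x y ha hx => ?_⟩
  have hx2 : x ^ 2 ≤ R ^ 2 := sq_le_sq' (abs_le.1 hx).1 (abs_le.1 hx).2
  rw [abs_mul, abs_pow, Real.abs_exp]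
  have h1 : Real.exp (-a * (x - y) ^ 2) ≤ Real.exp (-(α / 2) * (x - y) ^ 2) *
      (Real.exp (α / 2 * R ^ 2) * Real.exp (-(α / 4) * y ^ 2)) := by
    rw [← Real.exp_add, ← Real.exp_add]
    refine Real.exp_le_exp.2 ?_
    nlinarith [mul_le_mul_of_nonneg_right ha (sq_nonneg (x - y)), mul_nonneg hα.le
      (sq_nonneg (2 * x - y)), mul_le_mul_of_nonneg_left hx2 hα.le]
  calc |x - y| ^ n * Real.exp (-a * (x - y) ^ 2)
      ≤ |x - y| ^ n * (Real.exp (-(α / 2) * (x - y) ^ 2) *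
        (Real.exp (α / 2 * R ^ 2) * Real.exp (-(α / 4) * y ^ 2))) := by gcongr
    _ = (|x - y| ^ n * Real.exp (-(α / 2) * (x - y) ^ 2)) *
        (Real.exp (α / 2 * R ^ 2) * Real.exp (-(α / 4) * y ^ 2)) := by ring
    _ ≤ (1 + n.factorial / (α / 2) ^ n) *
        (Real.exp (α / 2 * R ^ 2) * Real.exp (-(α / 4) * y ^ 2)) := by
        gcongr; exact abs_pow_mul_exp_le n (half_pos hα) _
    _ = _ := by ring

namespace GaussIntegrable

variable {b : ℝ → ℝ}

lemma aestronglyMeasurable (hb : GaussIntegrable b) : AEStronglyMeasurable b := by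
  have h : b = fun y => Real.exp (y ^ 2) * (Real.exp (-1 * y ^ 2) * b y) := by
    ext y; rw [← mul_assoc, ← Real.exp_add]; simp
  rw [h]
  exact AEStronglyMeasurable.mul (by fun_prop) (hb 1 one_pos).aestronglyMeasurable

lemma integrable_moment (hb : GaussIntegrable b) (n : ℕ) {a : ℝ} (ha : 0 < a) (x : ℝ) :
    Integrable fun y => (x - y) ^ n * Real.exp (-a * (x - y) ^ 2) * b y := by
  obtain ⟨C, -, hC⟩ := exists_gaussian_bound n ha |x|
  refine ((hb (a / 4) (by positivity)).norm.const_mul C).mono'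
    (AEStronglyMeasurable.mul (by fun_prop) hb.aestronglyMeasurable) (ae_of_all _ fun y => ?_)
  rw [norm_mul, norm_mul (Real.exp _), ← mul_assoc]
  gcongr
  simpa using hC a x y le_rfl le_rfl

/-- Differentiation in `a` raises the order by two, and differentiation in `x` gives neighbouring
orders. The moments are thus closed under differentiation, which yields smoothness by induction. -/
lemma hasFDerivAt_moment (hb : GaussIntegrable b) (n : ℕ) {p : ℝ × ℝ} (hp : 0 < p.1) :
    HasFDerivAt (moment b n) ((-moment b (n + 2) p) • ContinuousLinearMap.fst ℝ ℝ ℝ +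
      momentX b n p • ContinuousLinearMap.snd ℝ ℝ ℝ) p := by
  set F : ℕ → ℝ × ℝ → ℝ → ℝ := fun n p y => (p.2 - y) ^ n * Real.exp (-p.1 * (p.2 - y) ^ 2) * b y
    with hF
  set F' : ℝ × ℝ → ℝ → ℝ × ℝ →L[ℝ] ℝ := fun p y =>
    (-F (n + 2) p y) • ContinuousLinearMap.fst ℝ ℝ ℝ +
      (n * F (n - 1) p y - 2 * p.1 * F (n + 1) p y) • ContinuousLinearMap.snd ℝ ℝ ℝ with hF'
  have hint : ∀ k, Integrable (F k p) := fun k => hb.integrable_moment k hp p.2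
  have hmeas : ∀ k q, AEStronglyMeasurable (F k q) := fun k q =>
    AEStronglyMeasurable.mul (by fun_prop) hb.aestronglyMeasurable
  have hval : ∫ y, F' p y = (-moment b (n + 2) p) • ContinuousLinearMap.fst ℝ ℝ ℝ +
      momentX b n p • ContinuousLinearMap.snd ℝ ℝ ℝ := by
    have i1 : Integrable fun y => -F (n + 2) p y := (hint (n + 2)).neg
    have i2 : Integrable fun y => n * F (n - 1) p y - 2 * p.1 * F (n + 1) p y :=
      ((hint (n - 1)).const_mul (n : ℝ)).sub ((hint (n + 1)).const_mul (2 * p.1))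
    have e1 : ∫ y, -F (n + 2) p y = -moment b (n + 2) p := integral_neg _
    have e2 : ∫ y, (n * F (n - 1) p y - 2 * p.1 * F (n + 1) p y) = momentX b n p := by
      rw [integral_sub ((hint (n - 1)).const_mul (n : ℝ)) ((hint (n + 1)).const_mul (2 * p.1)),
        integral_const_mul, integral_const_mul]
      rfl
    rw [hF', integral_add (i1.smul_const _) (i2.smul_const _), integral_smul_const,
      integral_smul_const, e1, e2]
  rw [← hval]
  -- On this neighbourhood `a ≥ p.1 / 2` gives a common Gaussian bound, and `a < 2 * p.1` is the
  -- source of the constant `4 * p.1` in the dominating function.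
  set s : Set (ℝ × ℝ) := {q | p.1 / 2 < q.1 ∧ q.1 < 2 * p.1 ∧ |q.2| < |p.2| + 1}
  have hs : s ∈ 𝓝 p := by
    have ho : IsOpen s := (isOpen_lt continuous_const continuous_fst).inter
      ((isOpen_lt continuous_fst continuous_const).inter
        (isOpen_lt continuous_snd.abs continuous_const))
    exact ho.mem_nhds ⟨by linarith, by linarith, by linarith⟩
  have hα : 0 < p.1 / 2 := half_pos hp
  choose C hC0 hC using fun k => exists_gaussian_bound k hα (|p.2| + 1)
  have hFb : ∀ k, ∀ q ∈ s, ∀ y, ‖F k q y‖ ≤ C k * ‖Real.exp (-(p.1 / 2 / 4) * y ^ 2) * b y‖ := by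
    intro k q hq y
    rw [norm_mul, norm_mul (Real.exp _), ← mul_assoc]
    gcongr
    simpa using hC k q.1 q.2 y hq.1.le hq.2.2.le
  refine hasFDerivAt_integral_of_dominated_of_fderiv_le (F := F n) (F' := F')
    (bound := fun y => (C (n + 2) + n * C (n - 1) + 4 * p.1 * C (n + 1)) *
      ‖Real.exp (-(p.1 / 2 / 4) * y ^ 2) * b y‖) hs (Eventually.of_forall fun q => hmeas n q)
    (hint n) ?_ ?_ ?_ ?_
  · exact ((hint (n + 2)).neg.aestronglyMeasurable.smul_const _).add
      (AEStronglyMeasurable.smul_const (((hmeas (n - 1) p).const_mul _).sub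
        ((hmeas (n + 1) p).const_mul _)) _)
  · refine ae_of_all _ fun y q hq => ?_
    have n1 : ‖ContinuousLinearMap.fst ℝ ℝ ℝ‖ ≤ 1 := ContinuousLinearMap.norm_fst_le ..
    have n2 : ‖ContinuousLinearMap.snd ℝ ℝ ℝ‖ ≤ 1 := ContinuousLinearMap.norm_snd_le ..
    have hq1 : |q.1| ≤ 2 * p.1 := by
      rw [abs_of_pos (hα.trans hq.1)]; exact hq.2.1.le
    calc ‖F' q y‖ ≤ ‖F (n + 2) q y‖ * 1 + (n * ‖F (n - 1) q y‖ + 2 * (2 * p.1) * ‖F (n + 1) q y‖) * 1 := by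
          refine (norm_add_le _ _).trans (add_le_add ?_ ?_)
          · rw [norm_smul, norm_neg]; gcongr
          · rw [norm_smul]
            gcongr
            refine (norm_sub_le _ _).trans (add_le_add ?_ ?_)
            · rw [norm_mul]; simp
            · rw [norm_mul, norm_mul, Real.norm_eq_abs q.1, Real.norm_ofNat]
              gcongr
      _ ≤ C (n + 2) * ‖Real.exp (-(p.1 / 2 / 4) * y ^ 2) * b y‖ * 1 +
          (n * (C (n - 1) * ‖Real.exp (-(p.1 / 2 / 4) * y ^ 2) * b y‖) +
            2 * (2 * p.1) * (C (n + 1) * ‖Real.exp (-(p.1 / 2 / 4) * y ^ 2) * b y‖)) * 1 := by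
          gcongr <;> exact hFb _ q hq y
      _ = _ := by ring
  · exact (hb (p.1 / 2 / 4) (by positivity)).norm.const_mul _
  · refine ae_of_all _ fun y q _ => ?_
    have hz : HasFDerivAt (fun q : ℝ × ℝ => q.2 - y) (ContinuousLinearMap.snd ℝ ℝ ℝ) q :=
      hasFDerivAt_snd.sub_const y
    have ha : HasFDerivAt (fun q : ℝ × ℝ => -q.1) (-ContinuousLinearMap.fst ℝ ℝ ℝ) q :=
      hasFDerivAt_fst.neg
    have h := ((hz.pow n).mul (ha.mul (hz.pow 2)).exp).mul_const (b y)
    convert! h using 1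
    ext <;> simp [hF', hF] <;> ring

lemma contDiffOn_moment (hb : GaussIntegrable b) (k n : ℕ) :
    ContDiffOn ℝ k (moment b n) {p | 0 < p.1} := by
  have ho : IsOpen {p : ℝ × ℝ | 0 < p.1} := isOpen_lt continuous_const continuous_fst
  induction k generalizing n with
  | zero => exact contDiffOn_zero.2 fun p hp =>
      (hb.hasFDerivAt_moment n hp).continuousAt.continuousWithinAt
  | succ k ih =>
    rw [Nat.cast_succ, contDiffOn_succ_iff_fderiv_of_isOpen ho]
    refine ⟨fun p hp => (hb.hasFDerivAt_moment n hp).differentiableAt.differentiableWithinAt,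
      by simp, ?_⟩
    have : ContDiffOn ℝ k (fun p => (-moment b (n + 2) p) • ContinuousLinearMap.fst ℝ ℝ ℝ +
      (n * moment b (n - 1) p - 2 * p.1 * moment b (n + 1) p) •
        ContinuousLinearMap.snd ℝ ℝ ℝ) {p | 0 < p.1} := by
      have h1 := ih (n + 2)
      have h2 := ih (n - 1)
      have h3 := ih (n + 1)
      fun_prop
    exact this.congr fun p hp => (hb.hasFDerivAt_moment n hp).fderiv

lemma contDiffAt_moment (hb : GaussIntegrable b) (n : ℕ) {p : ℝ × ℝ} (hp : 0 < p.1) :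
    ContDiffAt ℝ ∞ (moment b n) p :=
  (contDiffOn_infty.2 fun k => hb.contDiffOn_moment k n).contDiffAt
    ((isOpen_lt continuous_const continuous_fst).mem_nhds hp)

lemma hasDerivAt_moment_snd (hb : GaussIntegrable b) (n : ℕ) {a : ℝ} (ha : 0 < a) (x : ℝ) :
    HasDerivAt (fun z => moment b n (a, z)) (momentX b n (a, x)) x := by
  have h := (hb.hasFDerivAt_moment n (p := (a, x)) ha).comp_hasDerivAt x
    ((hasDerivAt_const x a).prodMk (hasDerivAt_id x))
  convert! h using 1
  simp

lemma hasDerivAt_moment_fst (hb : GaussIntegrable b) (n : ℕ) {f : ℝ → ℝ} {f' t : ℝ}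
    (hf : HasDerivAt f f' t) (ha : 0 < f t) (x : ℝ) :
    HasDerivAt (fun s => moment b n (f s, x)) (-moment b (n + 2) (f t, x) * f') t := by
  have h := (hb.hasFDerivAt_moment n (p := (f t, x)) ha).comp_hasDerivAt t
    (hf.prodMk (hasDerivAt_const t x))
  convert! h using 1
  simp

end GaussIntegrable

end RandomHeat

/-! ### The heat equation for the potential and the velocity, with `a = (4t)⁻¹`. -/

namespace RandomHeat

open Filter Topology
open scoped ContDiff

/-- The normalising constant of the heat kernel. -/
noncomputable def heatConst (t : ℝ) : ℝ := (Real.sqrt (4 * Real.pi * t))⁻¹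

lemma heatConst_pos {t : ℝ} (ht : 0 < t) : 0 < heatConst t := by
  have := Real.pi_pos
  unfold heatConst; positivity

/-- Writing `-1 / (2t)` through `(4t)⁻¹` turns the heat equation into a polynomial identity between
moments. -/
lemma hasDerivAt_heatConst {t : ℝ} (ht : 0 < t) :
    HasDerivAt heatConst (-(2 * (4 * t)⁻¹ * heatConst t)) t := by
  have hpi := Real.pi_pos
  have h1 : HasDerivAt (fun t => 4 * Real.pi * t) (4 * Real.pi) t := by
    simpa using (hasDerivAt_id t).const_mul (4 * Real.pi)
  have h2 := (h1.sqrt (by positivity)).inv (by positivity)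
  convert! h2 using 1
  rw [Real.sq_sqrt (by positivity), heatConst]
  field_simp
  ring

lemma hasDerivAt_inv_four_mul {t : ℝ} (ht : 0 < t) :
    HasDerivAt (fun t : ℝ => (4 * t)⁻¹) (-(4 * (4 * t)⁻¹ ^ 2)) t := by
  have h1 : HasDerivAt (fun t : ℝ => 4 * t) 4 t := by
    simpa using (hasDerivAt_id t).const_mul (4 : ℝ)
  convert! h1.inv (by positivity) using 1
  field_simp

lemma potential_eq (b : ℝ → ℝ) (t x : ℝ) :
    potential b t x = heatConst t * moment b 0 ((4 * t)⁻¹, x) := by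
  rw [potential, moment, ← integral_const_mul]
  congr 1 with y
  rw [heatKernel, heatConst, pow_zero, div_eq_mul_inv, one_mul]
  rw [show -(x - y) ^ 2 / (4 * t) = -(4 * t)⁻¹ * (x - y) ^ 2 by ring]
  ring

namespace GaussIntegrable

variable {b : ℝ → ℝ} {t : ℝ}

lemma hasDerivAt_potential_space (hb : GaussIntegrable b) (ht : 0 < t) (x : ℝ) :
    HasDerivAt (fun z => potential b t z)
      (-(2 * (4 * t)⁻¹ * heatConst t * moment b 1 ((4 * t)⁻¹, x))) x := by
  simp only [potential_eq]
  convert! (hb.hasDerivAt_moment_snd 0 (inv_pos.2 (mul_pos four_pos ht)) x).const_mul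
    (heatConst t) using 1
  simp [momentX]; ring

lemma velocity_eq (hb : GaussIntegrable b) (ht : 0 < t) (x : ℝ) :
    velocity b t x = 2 * (4 * t)⁻¹ * heatConst t * moment b 1 ((4 * t)⁻¹, x) := by
  rw [velocity, (hb.hasDerivAt_potential_space ht x).deriv, neg_neg]

lemma hasDerivAt_potential (hb : GaussIntegrable b) (ht : 0 < t) (x : ℝ) :
    HasDerivAt (fun z => potential b t z) (-velocity b t x) x := by
  rw [hb.velocity_eq ht]; exact hb.hasDerivAt_potential_space ht x

lemma partialX_velocity (hb : GaussIntegrable b) (ht : 0 < t) (x : ℝ) :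
    partialX (velocity b) t x = 2 * (4 * t)⁻¹ * heatConst t * momentX b 1 ((4 * t)⁻¹, x) := by
  have : (fun z => velocity b t z) =
      fun z => 2 * (4 * t)⁻¹ * heatConst t * moment b 1 ((4 * t)⁻¹, z) :=
    funext fun z => hb.velocity_eq ht z
  rw [partialX, this]
  exact ((hb.hasDerivAt_moment_snd 1 (inv_pos.2 (mul_pos four_pos ht)) x).const_mul _).deriv

lemma partialX_partialX_velocity (hb : GaussIntegrable b) (ht : 0 < t) (x : ℝ) :
    partialX (partialX (velocity b)) t x = 2 * (4 * t)⁻¹ * heatConst t *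
      (momentX b 0 ((4 * t)⁻¹, x) - 2 * (4 * t)⁻¹ * momentX b 2 ((4 * t)⁻¹, x)) := by
  have ha := inv_pos.2 (mul_pos four_pos ht)
  have : (fun z => partialX (velocity b) t z) = fun z => 2 * (4 * t)⁻¹ * heatConst t *
      (moment b 0 ((4 * t)⁻¹, z) - 2 * (4 * t)⁻¹ * moment b 2 ((4 * t)⁻¹, z)) :=
    funext fun z => by rw [hb.partialX_velocity ht]; simp [momentX]
  rw [partialX, this]
  exact (((hb.hasDerivAt_moment_snd 0 ha x).sub
    ((hb.hasDerivAt_moment_snd 2 ha x).const_mul _)).const_mul _).deriv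

lemma partialT_velocity (hb : GaussIntegrable b) (ht : 0 < t) (x : ℝ) :
    partialT (velocity b) t x = partialX (partialX (velocity b)) t x := by
  have ha := inv_pos.2 (mul_pos four_pos ht)
  have h : HasDerivAt (fun s => 2 * (4 * s)⁻¹ * heatConst s * moment b 1 ((4 * s)⁻¹, x)) _ t :=
    (((hasDerivAt_inv_four_mul ht).const_mul 2).mul (hasDerivAt_heatConst ht)).mul
      (hb.hasDerivAt_moment_fst 1 (hasDerivAt_inv_four_mul ht) ha x)
  have he : (fun s => velocity b s x) =ᶠ[𝓝 t]
      fun s => 2 * (4 * s)⁻¹ * heatConst s * moment b 1 ((4 * s)⁻¹, x) := by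
    filter_upwards [lt_mem_nhds ht] with s hs using hb.velocity_eq hs x
  rw [partialT, (h.congr_of_eventuallyEq he).deriv, hb.partialX_partialX_velocity ht]
  simp [momentX]
  ring

lemma hasDerivAt_potential_time (hb : GaussIntegrable b) (ht : 0 < t) (x : ℝ) :
    HasDerivAt (fun s => potential b s x) (-partialX (velocity b) t x) t := by
  have ha := inv_pos.2 (mul_pos four_pos ht)
  simp only [potential_eq]
  convert! (hasDerivAt_heatConst ht).mul
    (hb.hasDerivAt_moment_fst 0 (hasDerivAt_inv_four_mul ht) ha x) using 1
  rw [hb.partialX_velocity ht]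
  simp [momentX]
  ring

lemma smoothField_heatConst_mul_moment (hb : GaussIntegrable b) (n : ℕ) :
    SmoothField fun t x => heatConst t * moment b n ((4 * t)⁻¹, x) := by
  intro t x ht
  have hpi := Real.pi_pos
  have h1 : ContDiffAt ℝ ∞ (fun p : ℝ × ℝ => (4 * p.1)⁻¹) (t, x) :=
    (contDiffAt_const.mul contDiffAt_fst).inv (by positivity)
  have h2 : ContDiffAt ℝ ∞ (fun p : ℝ × ℝ => heatConst p.1) (t, x) :=
    ((contDiffAt_const.mul contDiffAt_fst).sqrt (by positivity)).inv (by positivity)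
  have h3 : ContDiffAt ℝ ∞ (moment b n) ((fun p : ℝ × ℝ => ((4 * p.1)⁻¹, p.2)) (t, x)) :=
    hb.contDiffAt_moment n (inv_pos.2 (mul_pos four_pos ht))
  exact h2.mul (ContDiffAt.comp (g := moment b n) (t, x) h3 (h1.prodMk contDiffAt_snd))

lemma smoothField_potential (hb : GaussIntegrable b) : SmoothField (potential b) :=
  (hb.smoothField_heatConst_mul_moment 0).congr fun t x _ => potential_eq b t x

lemma smoothField_velocity (hb : GaussIntegrable b) : SmoothField (velocity b) := by
  refine hb.smoothField_potential.partialX.neg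

/-- A triple zero of the velocity is a common zero of `momentX b n`, `n ≤ 2`. -/
lemma momentX_eq_zero (hb : GaussIntegrable b) (ht : 0 < t) {x : ℝ} (h0 : velocity b t x = 0)
    (h1 : partialX (velocity b) t x = 0) (h2 : partialX (partialX (velocity b)) t x = 0)
    (n : Fin 3) : momentX b n ((4 * t)⁻¹, x) = 0 := by
  have hc : 2 * (4 * t)⁻¹ * heatConst t ≠ 0 := by
    have := heatConst_pos ht
    positivity
  have ha : 2 * (4 * t)⁻¹ ≠ 0 := by positivity
  -- Up to nonzero factors, `u` is `momentX b 0`, `u_x` is `momentX b 1`, and `u_xx` is a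
  -- combination of `momentX b 0` and `momentX b 2`; the system is triangular.
  rw [hb.velocity_eq ht, mul_eq_zero, or_iff_right hc] at h0
  rw [hb.partialX_velocity ht, mul_eq_zero, or_iff_right hc] at h1
  have e0 : momentX b 0 ((4 * t)⁻¹, x) = 0 := by rw [momentX, zero_add, h0]; simp
  rw [hb.partialX_partialX_velocity ht, mul_eq_zero, or_iff_right hc, e0, zero_sub, neg_eq_zero,
    mul_eq_zero, or_iff_right ha] at h2
  fin_cases n
  exacts [e0, h1, h2]

end GaussIntegrable

end RandomHeat

/-! ### Roughness of a path and its potential at small times. -/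

namespace RandomHeat

open Filter Topology
open scoped ENNReal

/-- A weighted size of the increments of `b` around `q`, which controls the distance of the
potential at `q` from `b q`. -/
noncomputable def roughness (b : ℝ → ℝ) (q : ℝ) : ℝ≥0∞ :=
  ∫⁻ z, ENNReal.ofReal (|b (q + z) - b q| / (|z| + |z| ^ 3))

lemma heatKernel_nonneg (s z : ℝ) : 0 ≤ heatKernel s z :=
  div_nonneg (Real.exp_nonneg _) (Real.sqrt_nonneg _)

lemma heatKernel_sq {s : ℝ} (hs : 0 < s) (z : ℝ) :
    heatKernel s z ^ 2 = Real.exp (-(2 * (z ^ 2 / (4 * s)))) / (4 * Real.pi * s) := by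
  have := Real.pi_pos
  rw [heatKernel, div_pow, Real.sq_sqrt (by positivity), ← Real.exp_nat_mul]
  congr 2
  push_cast
  ring

/-- Squaring removes the square root: with `w = z² / (4s)` the square is `w * exp (-2w) / π`. -/
lemma heatKernel_mul_abs_le {s : ℝ} (hs : 0 < s) (z : ℝ) : heatKernel s z * |z| ≤ 1 := by
  have hpi := Real.pi_gt_three
  refine abs_le_of_sq_le_sq' ?_ zero_le_one |>.2
  set w := z ^ 2 / (4 * s) with hw
  have hw0 : 0 ≤ w := by positivity
  have hz : z ^ 2 = 4 * s * w := by rw [hw]; field_simp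
  have h1 : w ≤ Real.exp (2 * w) := by linarith [Real.add_one_le_exp (2 * w)]
  rw [mul_pow, sq_abs, heatKernel_sq hs, ← hw, hz, Real.exp_neg]
  rw [div_mul_eq_mul_div, div_le_iff₀ (by positivity), inv_mul_le_iff₀ (Real.exp_pos _)]
  nlinarith [mul_le_mul_of_nonneg_left h1 hs.le, mul_pos hs (Real.exp_pos (2 * w))]

lemma heatKernel_mul_abs_pow_le {s : ℝ} (hs : 0 < s) (z : ℝ) :
    heatKernel s z * |z| ^ 3 ≤ 8 * s := by
  have hpi := Real.pi_gt_three
  refine abs_le_of_sq_le_sq' ?_ (by positivity) |>.2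
  set w := z ^ 2 / (4 * s) with hw
  have hw0 : 0 ≤ w := by positivity
  have hz : z ^ 2 = 4 * s * w := by rw [hw]; field_simp
  have h1 : 8 * w ^ 3 ≤ 6 * Real.exp (2 * w) := by
    have := Real.pow_div_factorial_le_exp (2 * w) (by positivity) 3
    rw [div_le_iff₀ (by positivity)] at this
    simp [Nat.factorial] at this
    linarith
  rw [mul_pow, ← pow_mul, mul_comm 3 2, pow_mul, sq_abs, heatKernel_sq hs, ← hw, hz, Real.exp_neg]
  rw [div_mul_eq_mul_div, div_le_iff₀ (by positivity), inv_mul_le_iff₀ (Real.exp_pos _)]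
  have h2 := mul_le_mul_of_nonneg_left h1 (pow_nonneg hs.le 3)
  have h3 : 0 < s ^ 3 * Real.exp (2 * w) := by positivity
  nlinarith

/-- One weight dominates the kernels of all times `s ≤ T`, hence the uniformity in time of the
barriers. The point `z = 0` is excluded since there the quotient takes the default value `0`. -/
lemma heatKernel_mul_le {s T : ℝ} (hs : 0 < s) (hT : s ≤ T) (z β : ℝ) :
    heatKernel s z * |β| ≤ (1 + 8 * T) * (|β| / (|z| + |z| ^ 3)) ∨ z = 0 := by
  rcases eq_or_ne z 0 with hz | hz
  · exact .inr hz
  left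
  have h0 : 0 < |z| := abs_pos.2 hz
  rw [mul_div_assoc', le_div_iff₀ (by positivity)]
  calc heatKernel s z * |β| * (|z| + |z| ^ 3)
      = (heatKernel s z * |z| + heatKernel s z * |z| ^ 3) * |β| := by ring
    _ ≤ (1 + 8 * T) * |β| := by
      refine mul_le_mul_of_nonneg_right ?_ (abs_nonneg β)
      linarith [heatKernel_mul_abs_le hs z, heatKernel_mul_abs_pow_le hs z]

lemma heatKernel_eq_mul_exp (s z : ℝ) :
    heatKernel s z = heatConst s * Real.exp (-(4 * s)⁻¹ * z ^ 2) := by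
  rw [heatKernel, heatConst, show -z ^ 2 / (4 * s) = -(4 * s)⁻¹ * z ^ 2 by ring]
  ring

lemma integral_heatKernel {s : ℝ} (hs : 0 < s) : ∫ z, heatKernel s z = 1 := by
  have := Real.pi_pos
  simp only [heatKernel_eq_mul_exp]
  rw [integral_const_mul, integral_gaussian, heatConst, div_inv_eq_mul,
    show Real.pi * (4 * s) = 4 * Real.pi * s by ring]
  exact inv_mul_cancel₀ (by positivity)

lemma integrable_heatKernel {s : ℝ} (hs : 0 < s) : Integrable (heatKernel s) := by
  have : heatKernel s = fun z => heatConst s * Real.exp (-(4 * s)⁻¹ * z ^ 2) :=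
    funext (heatKernel_eq_mul_exp s)
  rw [this]
  exact (integrable_exp_neg_mul_sq (by positivity)).const_mul _

lemma continuous_heatKernel (s : ℝ) : Continuous (heatKernel s) := by
  unfold heatKernel; fun_prop

lemma ae_ne_zero : ∀ᵐ z : ℝ, z ≠ 0 := by
  simp [ae_iff]

variable {b : ℝ → ℝ} {q : ℝ}

lemma integrable_of_roughness (hb : Continuous b) (hq : roughness b q ≠ ∞) :
    Integrable fun z => |b (q + z) - b q| / (|z| + |z| ^ 3) :=
  (lintegral_ofReal_ne_top_iff_integrable (Measurable.aestronglyMeasurable (by fun_prop))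
    (ae_of_all _ fun z => by positivity)).1 hq

/-- Finite roughness at one point suffices, since `exp (-a y²) (|y| + |y|³)` is bounded. -/
lemma gaussIntegrable_of_roughness (hb : Continuous b) (h0 : roughness b 0 ≠ ∞) : GaussIntegrable b := by
  intro a ha
  have hi := integrable_of_roughness hb h0
  simp only [zero_add] at hi
  refine (((integrable_exp_neg_mul_sq ha).mul_const |b 0|).add
    (hi.const_mul ((1 + (1 : ℕ).factorial / a ^ 1) + (1 + (3 : ℕ).factorial / a ^ 3)))).mono'
    (Continuous.aestronglyMeasurable (by fun_prop)) ?_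
  filter_upwards [ae_ne_zero] with y hy
  have hy0 : 0 < |y| := abs_pos.2 hy
  have h1 := abs_pow_mul_exp_le 1 ha y
  have h3 := abs_pow_mul_exp_le 3 ha y
  have hb1 : |b y| ≤ |b 0| + |b y - b 0| := by
    have := abs_add_le (b 0) (b y - b 0)
    rwa [add_sub_cancel] at this
  have hexp : Real.exp (-a * y ^ 2) * |b y - b 0| ≤
      ((1 + (1 : ℕ).factorial / a ^ 1) + (1 + (3 : ℕ).factorial / a ^ 3)) *
        (|b y - b 0| / (|y| + |y| ^ 3)) := by
    rw [mul_div_assoc', le_div_iff₀ (by positivity)]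
    calc Real.exp (-a * y ^ 2) * |b y - b 0| * (|y| + |y| ^ 3)
        = (|y| ^ 1 * Real.exp (-a * y ^ 2) + |y| ^ 3 * Real.exp (-a * y ^ 2)) * |b y - b 0| := by
          ring
      _ ≤ _ := by gcongr
  rw [norm_mul, Real.norm_eq_abs, Real.norm_eq_abs, Real.abs_exp]
  calc Real.exp (-a * y ^ 2) * |b y|
      ≤ Real.exp (-a * y ^ 2) * (|b 0| + |b y - b 0|) := by gcongr
    _ ≤ _ := by rw [mul_add]; exact add_le_add le_rfl hexp

lemma integrable_heatKernel_mul (hb : Continuous b) {s : ℝ} (hs : 0 < s) (hq : roughness b q ≠ ∞) :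
    Integrable fun z => heatKernel s z * (b (q + z) - b q) := by
  refine ((integrable_of_roughness hb hq).const_mul (1 + 8 * s)).mono'
    (((continuous_heatKernel s).mul (by fun_prop)).aestronglyMeasurable) ?_
  filter_upwards [ae_ne_zero] with z hz
  rw [norm_mul, Real.norm_eq_abs, Real.norm_eq_abs, abs_of_nonneg (heatKernel_nonneg s z)]
  exact (heatKernel_mul_le hs le_rfl z _).resolve_right hz

lemma potential_sub_eq (hb : Continuous b) {s : ℝ} (hs : 0 < s) (hq : roughness b q ≠ ∞) :
    potential b s q - b q = ∫ z, heatKernel s z * (b (q + z) - b q) := by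
  have h1 : potential b s q = ∫ z, heatKernel s z * b (q + z) := by
    rw [potential, ← integral_add_left_eq_self _ q]
    congr 1 with z
    rw [heatKernel, heatKernel]
    congr 4
    ring
  have hi := integrable_heatKernel_mul hb hs hq
  have h2 : ∫ z, heatKernel s z * b (q + z) =
      ∫ z, (heatKernel s z * (b (q + z) - b q) + heatKernel s z * b q) := by
    congr 1 with z; ring
  rw [h1, h2, integral_add hi ((integrable_heatKernel hs).mul_const _), integral_mul_const,
    integral_heatKernel hs]
  ring

lemma abs_potential_sub_le (hb : Continuous b) {s T : ℝ} (hs : s ∈ Ioc 0 T) (hq : roughness b q ≠ ∞) :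
    |potential b s q - b q| ≤ (1 + 8 * T) * (roughness b q).toReal := by
  have hr : (roughness b q).toReal = ∫ z, |b (q + z) - b q| / (|z| + |z| ^ 3) := by
    rw [roughness, integral_eq_lintegral_of_nonneg_ae (ae_of_all _ fun z => by positivity)
      (Measurable.aestronglyMeasurable (by fun_prop))]
  rw [potential_sub_eq hb hs.1 hq, hr, ← integral_const_mul, ← Real.norm_eq_abs]
  refine norm_integral_le_of_norm_le ((integrable_of_roughness hb hq).const_mul _) ?_
  filter_upwards [ae_ne_zero] with z hz
  rw [norm_mul, Real.norm_eq_abs, Real.norm_eq_abs, abs_of_nonneg (heatKernel_nonneg s z)]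
  exact (heatKernel_mul_le hs.1 hs.2 z _).resolve_right hz

/-- Dominated convergence, with the roughness integrand as majorant; for `z ≠ 0` the kernel tends to
`0` because it is at most `8s / |z|³`. -/
lemma tendsto_potential (hb : Continuous b) (hq : roughness b q ≠ ∞) :
    Tendsto (fun s => potential b s q) (𝓝[>] 0) (𝓝 (b q)) := by
  suffices Tendsto (fun s => ∫ z, heatKernel s z * (b (q + z) - b q)) (𝓝[>] 0)
      (𝓝 (∫ _ : ℝ, (0 : ℝ))) by
    rw [integral_zero] at this
    refine tendsto_sub_nhds_zero_iff.1 (this.congr' ?_)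
    filter_upwards [self_mem_nhdsWithin] with s hs using (potential_sub_eq hb hs hq).symm
  refine tendsto_integral_filter_of_dominated_convergence
    (fun z => (1 + 8 * 1) * (|b (q + z) - b q| / (|z| + |z| ^ 3))) ?_ ?_
    ((integrable_of_roughness hb hq).const_mul _) ?_
  · exact Eventually.of_forall fun s =>
      ((continuous_heatKernel s).mul (by fun_prop)).aestronglyMeasurable
  · filter_upwards [Ioc_mem_nhdsGT one_pos] with s hs
    filter_upwards [ae_ne_zero] with z hz
    rw [norm_mul, Real.norm_eq_abs, Real.norm_eq_abs, abs_of_nonneg (heatKernel_nonneg s z)]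
    exact (heatKernel_mul_le hs.1 hs.2 z _).resolve_right hz
  · filter_upwards [ae_ne_zero] with z hz
    have hz0 : 0 < |z| := abs_pos.2 hz
    have hlim : Tendsto (fun s : ℝ => 8 * s / |z| ^ 3) (𝓝[>] 0) (𝓝 0) := by
      have : ContinuousAt (fun s : ℝ => 8 * s / |z| ^ 3) 0 := by fun_prop
      simpa using this.tendsto.mono_left nhdsWithin_le_nhds
    have hk : Tendsto (fun s => heatKernel s z) (𝓝[>] 0) (𝓝 0) := by
      refine tendsto_of_tendsto_of_tendsto_of_le_of_le' tendsto_const_nhds hlim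
        (Eventually.of_forall fun s => heatKernel_nonneg s z) ?_
      filter_upwards [self_mem_nhdsWithin] with s hs
      rw [le_div_iff₀ (by positivity)]
      exact heatKernel_mul_abs_pow_le hs z
    simpa using hk.mul_const (b (q + z) - b q)

end RandomHeat

/-! ### From path properties to the deterministic hypotheses. -/

namespace RandomHeat

open Filter Topology
open scoped ENNReal

/-- `b` takes large values, compared to its roughness, at arbitrarily large points. -/
def HasHighPoints (b : ℝ → ℝ) : Prop :=
  ∀ n : ℕ, ∃ M : ℝ, n < M ∧ roughness b M ≠ ∞ ∧ n + n * (roughness b M).toReal < b M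

lemma potential_neg (b : ℝ → ℝ) (t x : ℝ) : potential (fun y => -b y) t x = -potential b t x := by
  simp only [potential, mul_neg, integral_neg]

lemma potential_comp_neg (b : ℝ → ℝ) (t x : ℝ) :
    potential (fun y => b (-y)) t x = potential b t (-x) := by
  rw [potential, ← integral_neg_eq_self]
  congr 1 with y
  rw [neg_neg, heatKernel, heatKernel]
  congr 4
  ring

/-- The potential at `M` differs from `b M` by at most `1 + 8T` times the roughness; an `n` above
`c`, `x` and `1 + 8T` makes the high point win. -/
lemma HasHighPoints.exists_lt_potential {b : ℝ → ℝ} (h : HasHighPoints b) (hb : Continuous b)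
    (T c x : ℝ) : ∃ M > x, ∀ s ∈ Ioc 0 T, c < potential b s M := by
  obtain ⟨n, hn⟩ := exists_nat_ge (max (max c x) (1 + 8 * T))
  obtain ⟨hn1, hn2⟩ := max_le_iff.1 hn
  obtain ⟨hc, hx⟩ := max_le_iff.1 hn1
  obtain ⟨M, hM, hr, hlt⟩ := h n
  refine ⟨M, hx.trans_lt hM, fun s hs => ?_⟩
  have h1 := (abs_le.1 (abs_potential_sub_le hb hs hr)).1
  have h2 := mul_le_mul_of_nonneg_right hn2 (roughness b M).toReal_nonneg
  linarith

theorem barrierPair_of_path {b : ℝ → ℝ} (hb : Continuous b)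
    (hrough : ∀ q : ℚ, roughness b q ≠ ∞) (hinj : ∀ p q : ℚ, 0 ≤ p * q → p ≠ q → b p ≠ b q)
    (hnd : ∀ a x : ℝ, 0 < a → ∃ n : Fin 3, momentX b n (a, x) ≠ 0)
    (h1 : HasHighPoints b) (h2 : HasHighPoints fun y => -b y)
    (h3 : HasHighPoints fun y => b (-y)) (h4 : HasHighPoints fun y => -b (-y)) :
    BarrierPair (potential b) (velocity b) := by
  have hG : GaussIntegrable b := gaussIntegrable_of_roughness hb (by simpa using hrough 0)
  have hb' : Continuous fun y => b (-y) := hb.comp continuous_neg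
  refine ⟨hG.smoothField_potential, hG.smoothField_velocity,
    fun t x ht => hG.hasDerivAt_potential ht x, fun t x ht => hG.hasDerivAt_potential_time ht x,
    fun t x ht => hG.partialT_velocity ht x, ?_, ?_, ?_, ?_, ?_, ?_⟩
  · intro t x ht e0 e1 e2
    obtain ⟨n, hn⟩ := hnd (4 * t)⁻¹ x (by positivity)
    exact hn (hG.momentX_eq_zero ht e0 e1 e2 n)
  -- Distinct values are assumed only for points on the same side of `0`; this is enough, as every
  -- interval contains one on a single side.
  · have key : ∀ a c : ℝ, a < c → 0 ≤ a ∨ c ≤ 0 → ∃ p ∈ Ioo a c, ∃ q ∈ Ioo a c, ∃ v w, v ≠ w ∧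
        Tendsto (fun s => potential b s p) (𝓝[>] 0) (𝓝 v) ∧
        Tendsto (fun s => potential b s q) (𝓝[>] 0) (𝓝 w) := by
      intro a c hac h
      obtain ⟨p, hap, hpc⟩ := exists_rat_btwn hac
      obtain ⟨q, hpq, hqc⟩ := exists_rat_btwn hpc
      have hsign : 0 ≤ (p : ℝ) * q := by
        rcases h with h | h
        · exact mul_nonneg (by linarith) (by linarith)
        · exact mul_nonneg_of_nonpos_of_nonpos (by linarith) (by linarith)
      exact ⟨p, ⟨hap, hpc⟩, q, ⟨hap.trans hpq, hqc⟩, _, _,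
        hinj p q (by exact_mod_cast hsign) (by rintro rfl; exact lt_irrefl _ hpq),
        tendsto_potential hb (hrough p), tendsto_potential hb (hrough q)⟩
    intro a c hac
    rcases le_or_gt c 0 with hc | hc
    · exact key a c hac (.inr hc)
    · obtain ⟨p, hp, q, hq, h⟩ := key (max a 0) c (max_lt hac hc) (.inl (le_max_right _ _))
      have hsub := Ioo_subset_Ioo_left (b := c) (le_max_left a 0)
      exact ⟨p, hsub hp, q, hsub hq, h⟩
  · exact h1.exists_lt_potential hb
  · intro T c x
    obtain ⟨M, hM, h⟩ := h3.exists_lt_potential hb' T c (-x)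
    exact ⟨-M, by linarith, fun s hs => by simpa only [potential_comp_neg] using h s hs⟩
  · intro T c x
    obtain ⟨M, hM, h⟩ := h2.exists_lt_potential hb.neg T (-c) x
    refine ⟨M, hM, fun s hs => ?_⟩
    have := h s hs
    rw [potential_neg] at this
    linarith
  · intro T c x
    obtain ⟨M, hM, h⟩ := h4.exists_lt_potential hb'.neg T (-c) (-x)
    refine ⟨-M, by linarith, fun s hs => ?_⟩
    have := h s hs
    rw [potential_neg (fun y => b (-y)), potential_comp_neg] at this
    linarith

end RandomHeat

/-! ### Regular versions of Brownian motion. -/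

namespace RandomHeat

open Filter Topology
open scoped ENNReal

variable {Ω : Type*} [MeasurableSpace Ω] {P : Measure Ω} {B : ℝ → Ω → ℝ}

/-- A two-sided Brownian motion that is measurable at all points and all of whose paths are
continuous. -/
structure IsRegularBrownian (B : ℝ → Ω → ℝ) (P : Measure Ω) : Prop
    extends IsTwoSidedBrownian B P where
  measurable : ∀ y, Measurable (B y)
  continuous : ∀ ω, Continuous fun y => B y ω

lemma continuous_of_halves {f : ℝ → ℝ} (h₁ : Continuous fun x : ℝ≥0 => f x)
    (h₂ : Continuous fun x : ℝ≥0 => f (-x)) : Continuous f := by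
  have : f = fun y => f (y.toNNReal : ℝ) + f (-((-y).toNNReal : ℝ)) - f 0 := by
    ext y
    rcases le_total 0 y with hy | hy
    · simp [Real.toNNReal_of_nonpos (neg_nonpos.2 hy), Real.coe_toNNReal y hy]
    · simp [Real.toNNReal_of_nonpos hy, Real.coe_toNNReal (-y) (neg_nonneg.2 hy)]
  rw [this]
  exact ((h₁.comp continuous_real_toNNReal).add
    (h₂.comp (continuous_real_toNNReal.comp continuous_neg))).sub continuous_const

namespace IsTwoSidedBrownian

lemma ae_continuous (hB : IsTwoSidedBrownian B P) : ∀ᵐ ω ∂P, Continuous fun y => B y ω := by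
  filter_upwards [hB.right.cont, hB.left.cont] with ω h1 h2 using continuous_of_halves h1 h2

lemma aemeasurable (hB : IsTwoSidedBrownian B P) (y : ℝ) : AEMeasurable (B y) P := by
  rcases le_total 0 y with hy | hy
  · simpa [Real.coe_toNNReal y hy] using hB.right.aemeasurable y.toNNReal
  · simpa [Real.coe_toNNReal (-y) (neg_nonneg.2 hy)] using hB.left.aemeasurable (-y).toNNReal

lemma congr (hB : IsTwoSidedBrownian B P) {B' : ℝ → Ω → ℝ}
    (h : ∀ᵐ ω ∂P, ∀ y, B' y ω = B y ω) : IsTwoSidedBrownian B' P where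
  right :=
    { toIsPreBrownianReal := hB.right.toIsPreBrownianReal.congr fun t =>
        h.mono fun ω hω => (hω t).symm
      cont := by
        filter_upwards [h, hB.right.cont] with ω hω hc
        simpa only [hω] using hc }
  left :=
    { toIsPreBrownianReal := hB.left.toIsPreBrownianReal.congr fun t =>
        h.mono fun ω hω => (hω (-t)).symm
      cont := by
        filter_upwards [h, hB.left.cont] with ω hω hc
        simpa only [hω] using hc }
  indep := hB.indep.congr (h.mono fun ω hω => funext fun x => (hω x).symm)
    (h.mono fun ω hω => funext fun x => (hω (-x)).symm)

lemma neg (hB : IsTwoSidedBrownian B P) : IsTwoSidedBrownian (fun y ω => -B y ω) P where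
  right := hB.right.neg
  left := hB.left.neg
  indep := by
    have hm : Measurable fun (f : ℝ≥0 → ℝ) x => -f x := by fun_prop
    exact hB.indep.comp hm hm

lemma comp_neg (hB : IsTwoSidedBrownian B P) : IsTwoSidedBrownian (fun y => B (-y)) P where
  right := hB.left
  left := by simpa using hB.right
  indep := by simpa using hB.indep.symm

/-- Every two-sided Brownian motion is indistinguishable from a regular one. -/
lemma exists_regular (hB : IsTwoSidedBrownian B P) :
    ∃ B' : ℝ → Ω → ℝ, IsRegularBrownian B' P ∧ ∀ᵐ ω ∂P, ∀ y, B' y ω = B y ω := by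
  have hae : ∀ᵐ ω ∂P, (Continuous fun y => B y ω) ∧
      ∀ q : ℚ, B q ω = (hB.aemeasurable q).mk (B q) ω :=
    hB.ae_continuous.and (ae_all_iff.2 fun q => (hB.aemeasurable q).ae_eq_mk)
  -- The path is set to `0` on a measurable null set `N`; off `N` it is continuous and agrees at
  -- rationals with measurable versions, so its value at any `y` is a limit of measurable functions.
  obtain ⟨N, hN, hNm, hN0⟩ := exists_measurable_superset_of_null (ae_iff.1 hae)
  have hgood : ∀ ω ∉ N, (Continuous fun y => B y ω) ∧
      ∀ q : ℚ, B q ω = (hB.aemeasurable q).mk (B q) ω := fun ω hω => by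
    by_contra h
    exact hω (hN h)
  have heq : ∀ᵐ ω ∂P, ∀ y, Nᶜ.indicator (B y) ω = B y ω := by
    filter_upwards [measure_eq_zero_iff_ae_notMem.1 hN0] with ω hω y
    exact indicator_of_mem hω _
  have hcont : ∀ ω, Continuous fun y => Nᶜ.indicator (B y) ω := fun ω => by
    by_cases hω : ω ∈ N
    · simpa [hω] using continuous_const
    · simpa [hω] using (hgood ω hω).1
  have hmq : ∀ q : ℚ, Measurable (Nᶜ.indicator (B q)) := fun q => by
    have : Nᶜ.indicator (B q) = Nᶜ.indicator ((hB.aemeasurable q).mk (B q)) := by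
      ext ω
      by_cases hω : ω ∈ N
      · simp [hω]
      · simpa [hω] using (hgood ω hω).2 q
    rw [this]
    exact (hB.aemeasurable q).measurable_mk.indicator hNm.compl
  refine ⟨fun y => Nᶜ.indicator (B y), ⟨hB.congr heq, fun y => ?_, hcont⟩, heq⟩
  obtain ⟨q, -, -, hq⟩ := Real.exists_seq_rat_strictMono_tendsto y
  exact measurable_of_tendsto_metrizable (fun n => hmq (q n))
    (tendsto_pi_nhds.2 fun ω => ((hcont ω).tendsto y).comp hq)

end IsTwoSidedBrownian

namespace IsRegularBrownian

lemma neg (hB : IsRegularBrownian B P) : IsRegularBrownian (fun y ω => -B y ω) P :=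
  ⟨hB.toIsTwoSidedBrownian.neg, fun y => (hB.measurable y).neg, fun ω => (hB.continuous ω).neg⟩

lemma comp_neg (hB : IsRegularBrownian B P) : IsRegularBrownian (fun y => B (-y)) P :=
  ⟨hB.toIsTwoSidedBrownian.comp_neg, fun y => hB.measurable (-y),
    fun ω => (hB.continuous ω).comp continuous_neg⟩

lemma measurable_uncurry (hB : IsRegularBrownian B P) :
    Measurable fun p : ℝ × Ω => B p.1 p.2 :=
  measurable_uncurry_of_continuous_of_measurable hB.continuous hB.measurable

end IsRegularBrownian

/-- The first absolute moment of a centred Gaussian variable is at most its standard deviation. -/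
lemma lintegral_abs_le_of_hasLaw {X : Ω → ℝ} {v : ℝ≥0} (hX : HasLaw X (gaussianReal 0 v) P) :
    ∫⁻ ω, ENNReal.ofReal |X ω| ∂P ≤ ENNReal.ofReal √v := by
  have : IsProbabilityMeasure P := hX.isProbabilityMeasure
  have hmem : MemLp X 2 P := hX.hasGaussianLaw.memLp_two
  have hmean : ∫ ω, X ω ∂P = 0 := by rw [hX.integral_eq, integral_id_gaussianReal]
  have hvar : ∫ ω, (|X| ^ 2) ω ∂P = v := by
    have h := variance_eq_sub hmem
    rw [hX.variance_eq, variance_id_gaussianReal, hmean] at h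
    have e : |X| ^ 2 = X ^ 2 := by ext ω; simp
    rw [e]
    simpa using h.symm
  have hnn := variance_nonneg |X| P
  rw [variance_eq_sub hmem.abs, hvar] at hnn
  rw [← ofReal_integral_eq_lintegral_ofReal (hmem.integrable one_le_two).abs
    (ae_of_all _ fun ω => abs_nonneg _)]
  exact ENNReal.ofReal_le_ofReal (Real.le_sqrt_of_sq_le (by linarith!))

end RandomHeat

/-! ### Expected roughness of Brownian motion. -/

namespace RandomHeat

open Filter Topology
open scoped ENNReal

variable {Ω : Type*} [MeasurableSpace Ω] {P : Measure Ω} {B : ℝ → Ω → ℝ}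

lemma lintegral_abs_sub_le_of_preBrownian {X : ℝ≥0 → Ω → ℝ} (hX : IsPreBrownianReal X P)
    (s t : ℝ≥0) : ∫⁻ ω, ENNReal.ofReal |X s ω - X t ω| ∂P ≤ ENNReal.ofReal √|(s : ℝ) - t| := by
  have := lintegral_abs_le_of_hasLaw (hX.hasLaw_sub s t)
  simpa [Real.dist_eq] using this

/-- The factor `2` pays for points of opposite signs, which are compared through `B 0`. -/
lemma IsTwoSidedBrownian.lintegral_abs_sub_le (hB : IsTwoSidedBrownian B P) (x y : ℝ) :
    ∫⁻ ω, ENNReal.ofReal |B x ω - B y ω| ∂P ≤ ENNReal.ofReal (2 * √|x - y|) := by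
  have hpos : ∀ x y : ℝ, 0 ≤ x → 0 ≤ y →
      ∫⁻ ω, ENNReal.ofReal |B x ω - B y ω| ∂P ≤ ENNReal.ofReal √|x - y| := fun x y hx hy => by
    simpa [hx, hy] using
      lintegral_abs_sub_le_of_preBrownian hB.right.toIsPreBrownianReal x.toNNReal y.toNNReal
  have hneg : ∀ x y : ℝ, x ≤ 0 → y ≤ 0 →
      ∫⁻ ω, ENNReal.ofReal |B x ω - B y ω| ∂P ≤ ENNReal.ofReal √|x - y| := fun x y hx hy => by
    have := lintegral_abs_sub_le_of_preBrownian hB.left.toIsPreBrownianReal (-x).toNNReal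
      (-y).toNNReal
    rw [Real.coe_toNNReal (-x) (by linarith), Real.coe_toNNReal (-y) (by linarith)] at this
    rw [abs_sub_comm x y]
    simpa [← sub_eq_neg_add] using this
  have h0 : ∀ x : ℝ, ∫⁻ ω, ENNReal.ofReal |B x ω - B 0 ω| ∂P ≤ ENNReal.ofReal √|x| := fun x => by
    rcases le_total 0 x with hx | hx
    · simpa using hpos x 0 hx le_rfl
    · simpa using hneg x 0 hx le_rfl
  have hle : ENNReal.ofReal √|x - y| ≤ ENNReal.ofReal (2 * √|x - y|) :=
    ENNReal.ofReal_le_ofReal (by linarith [Real.sqrt_nonneg |x - y|])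
  have hopp : |x| ≤ |x - y| → |y| ≤ |x - y| →
      ∫⁻ ω, ENNReal.ofReal |B x ω - B y ω| ∂P ≤ ENNReal.ofReal (2 * √|x - y|) := fun hx hy => by
    calc ∫⁻ ω, ENNReal.ofReal |B x ω - B y ω| ∂P
        ≤ ∫⁻ ω, (ENNReal.ofReal |B x ω - B 0 ω| + ENNReal.ofReal |B y ω - B 0 ω|) ∂P := by
          refine lintegral_mono fun ω => ?_
          rw [← ENNReal.ofReal_add (abs_nonneg _) (abs_nonneg _)]
          refine ENNReal.ofReal_le_ofReal ?_
          rw [abs_sub_comm (B y ω)]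
          exact abs_sub_le _ _ _
      _ = _ := lintegral_add_left'
          (((hB.aemeasurable x).sub (hB.aemeasurable 0)).abs.ennreal_ofReal) _
      _ ≤ ENNReal.ofReal √|x| + ENNReal.ofReal √|y| := add_le_add (h0 x) (h0 y)
      _ ≤ ENNReal.ofReal √|x - y| + ENNReal.ofReal √|x - y| := by gcongr
      _ = _ := by rw [← ENNReal.ofReal_add (Real.sqrt_nonneg _) (Real.sqrt_nonneg _), two_mul]
  rcases le_total 0 x with hx | hx <;> rcases le_total 0 y with hy | hy
  · exact (hpos x y hx hy).trans hle
  · refine hopp ?_ ?_ <;>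
      simp only [abs_of_nonneg hx, abs_of_nonpos hy, abs_of_nonneg (show 0 ≤ x - y by linarith)] <;>
      linarith
  · refine hopp ?_ ?_ <;>
      simp only [abs_of_nonneg hy, abs_of_nonpos hx, abs_of_nonpos (show x - y ≤ 0 by linarith)] <;>
      linarith
  · exact (hneg x y hx hy).trans hle

lemma integrable_comp_abs_of_Ioi {f : ℝ → ℝ} (hf : IntegrableOn f (Ioi 0)) :
    Integrable fun z => f |z| := by
  have h1 : IntegrableOn (fun z => f |z|) (Ioi 0) :=
    hf.congr_fun (fun z hz => by simp [abs_of_pos (mem_Ioi.1 hz)]) measurableSet_Ioi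
  have h2 : IntegrableOn (fun z => f |z|) (Iio 0) := by
    have := (h1.comp_neg)
    simpa using this
  rw [← integrableOn_univ, ← Iio_union_Ici (a := (0 : ℝ)), integrableOn_union,
    integrableOn_Ici_iff_integrableOn_Ioi]
  exact ⟨h2, h1⟩

/-- An upper bound for the expected roughness of Brownian motion at any point. -/
noncomputable def roughnessBound : ℝ≥0∞ :=
  ∫⁻ z : ℝ, ENNReal.ofReal (2 * √|z| / (|z| + |z| ^ 3))

/-- The integrand is at most `2 z^(-1/2)` on `(0, 1]` and `2 z^(-2)` beyond; this is why the weight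
combines `|z|` and `|z|³`. -/
lemma roughnessBound_ne_top : roughnessBound ≠ ∞ := by
  have hmeas : Measurable fun z : ℝ => 2 * √z / (z + z ^ 3) := by fun_prop
  have h1 : IntegrableOn (fun z : ℝ => 2 * √z / (z + z ^ 3)) (Ioc 0 1) := by
    have hi : IntegrableOn (fun z : ℝ => z ^ (-(1 / 2) : ℝ)) (Ioc 0 1) :=
      (intervalIntegrable_iff_integrableOn_Ioc_of_le zero_le_one).1
        (intervalIntegral.intervalIntegrable_rpow' (by norm_num))
    refine (hi.const_mul 2).mono' hmeas.aestronglyMeasurable ?_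
    filter_upwards [ae_restrict_mem measurableSet_Ioc] with z hz
    have hz0 := hz.1
    rw [Real.norm_of_nonneg (by positivity), Real.rpow_neg hz0.le, ← Real.sqrt_eq_rpow,
      div_le_iff₀ (by positivity), mul_assoc]
    gcongr
    rw [inv_mul_eq_div, le_div_iff₀ (by positivity), Real.mul_self_sqrt hz0.le]
    linarith [pow_pos hz0 3]
  have h2 : IntegrableOn (fun z : ℝ => 2 * √z / (z + z ^ 3)) (Ioi 1) := by
    have hi : IntegrableOn (fun z : ℝ => z ^ (-2 : ℝ)) (Ioi 1) :=
      integrableOn_Ioi_rpow_of_lt (by norm_num) one_pos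
    refine (hi.const_mul 2).mono' hmeas.aestronglyMeasurable ?_
    filter_upwards [ae_restrict_mem measurableSet_Ioi] with z hz
    have hz1 : 1 < z := hz
    have hz0 : 0 < z := one_pos.trans hz1
    have hsq : √z ≤ z := by
      rw [Real.sqrt_le_left hz0.le]; nlinarith
    rw [Real.norm_of_nonneg (by positivity), Real.rpow_neg hz0.le, Real.rpow_two,
      div_le_iff₀ (by positivity), mul_assoc]
    gcongr
    rw [inv_mul_eq_div, le_div_iff₀ (by positivity)]
    nlinarith [mul_le_mul_of_nonneg_right hsq (sq_nonneg z)]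
  have h3 : IntegrableOn (fun z : ℝ => 2 * √z / (z + z ^ 3)) (Ioi 0) := by
    rw [← Ioc_union_Ioi_eq_Ioi (zero_le_one (α := ℝ))]
    exact h1.union h2
  have h4 : Integrable fun z : ℝ => 2 * √|z| / (|z| + |z| ^ 3) :=
    integrable_comp_abs_of_Ioi h3
  rw [roughnessBound]
  exact (lintegral_ofReal_ne_top_iff_integrable h4.aestronglyMeasurable
    (ae_of_all _ fun z => by positivity)).2 h4

namespace IsRegularBrownian

lemma measurable_roughness_aux (hB : IsRegularBrownian B P) (q : ℝ) :
    Measurable fun p : Ω × ℝ =>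
      ENNReal.ofReal (|B (q + p.2) p.1 - B q p.1| / (|p.2| + |p.2| ^ 3)) := by
  have h1 : Measurable fun p : Ω × ℝ => B (q + p.2) p.1 :=
    hB.measurable_uncurry.comp ((measurable_const.add measurable_snd).prodMk measurable_fst)
  have h2 : Measurable fun p : Ω × ℝ => B q p.1 := (hB.measurable q).comp measurable_fst
  have h3 : Measurable fun p : Ω × ℝ => |p.2| := measurable_snd.abs
  exact ((h1.sub h2).abs.div (h3.add (h3.pow_const 3))).ennreal_ofReal

lemma measurable_roughness (hB : IsRegularBrownian B P) (q : ℝ) :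
    Measurable fun ω => roughness (fun y => B y ω) q :=
  (hB.measurable_roughness_aux q).lintegral_prod_right'

lemma lintegral_roughness_le [SFinite P] (hB : IsRegularBrownian B P) (q : ℝ) :
    ∫⁻ ω, roughness (fun y => B y ω) q ∂P ≤ roughnessBound := by
  simp only [roughness]
  rw [lintegral_lintegral_swap (hB.measurable_roughness_aux q).aemeasurable]
  refine lintegral_mono fun z => ?_
  simp only [div_eq_mul_inv]
  have hw : 0 ≤ (|z| + |z| ^ 3)⁻¹ := by positivity
  simp only [ENNReal.ofReal_mul (abs_nonneg _)]
  rw [lintegral_mul_const' _ _ ENNReal.ofReal_ne_top, ENNReal.ofReal_mul (by positivity)]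
  gcongr
  simpa using hB.lintegral_abs_sub_le (q + z) q

lemma ae_roughness_ne_top [SFinite P] (hB : IsRegularBrownian B P) (q : ℝ) :
    ∀ᵐ ω ∂P, roughness (fun y => B y ω) q ≠ ∞ :=
  (ae_lt_top (hB.measurable_roughness q)
    ((hB.lintegral_roughness_le q).trans_lt roughnessBound_ne_top.lt_top).ne).mono fun _ h => h.ne

end IsRegularBrownian

end RandomHeat

/-! ### High points by Borel–Cantelli along a sparse sequence. -/

namespace RandomHeat

open Filter Topology
open scoped ENNReal

variable {Ω : Type*} [MeasurableSpace Ω] {P : Measure Ω} {B : ℝ → Ω → ℝ}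

lemma ae_ne_of_preBrownian {X : ℝ≥0 → Ω → ℝ} (hX : IsPreBrownianReal X P) {s t : ℝ≥0}
    (hst : s ≠ t) : ∀ᵐ ω ∂P, X s ω ≠ X t ω := by
  have hv : nndist (s : ℝ) t ≠ 0 := by simpa using hst
  have := nullSingletonClass_gaussianReal (μ := 0) hv
  have h : ∀ᵐ x ∂(gaussianReal 0 (nndist (s : ℝ) t)), x ≠ 0 := by simp [ae_iff]
  have h' := ((hX.hasLaw_sub s t).ae_iff (p := fun x => x ≠ 0)
    (measurableSet_singleton (0 : ℝ)).compl.mem).2 h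
  filter_upwards [h'] with ω hω heq
  exact hω (by simp [heq])

lemma IsTwoSidedBrownian.ae_ne (hB : IsTwoSidedBrownian B P) {x y : ℝ} (hxy : 0 ≤ x * y)
    (hne : x ≠ y) : ∀ᵐ ω ∂P, B x ω ≠ B y ω := by
  rcases mul_nonneg_iff.1 hxy with ⟨hx, hy⟩ | ⟨hx, hy⟩
  · have h := ae_ne_of_preBrownian hB.right.toIsPreBrownianReal (s := x.toNNReal)
      (t := y.toNNReal) (by rwa [ne_eq, Real.toNNReal_eq_toNNReal_iff hx hy])
    simpa [hx, hy] using h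
  · have h := ae_ne_of_preBrownian hB.left.toIsPreBrownianReal (s := (-x).toNNReal)
      (t := (-y).toNNReal) (by
        rwa [ne_eq, Real.toNNReal_eq_toNNReal_iff (by linarith) (by linarith), neg_inj])
    rw [Real.coe_toNNReal (-x) (by linarith), Real.coe_toNNReal (-y) (by linarith)] at h
    simpa using h

/-- The positions `16 ^ k²`. -/
noncomputable def sparsePoint (k : ℕ) : ℝ≥0 := (4 ^ k ^ 2) ^ 2

lemma sparsePoint_coe (k : ℕ) : (sparsePoint k : ℝ) = (4 ^ k ^ 2) ^ 2 := by simp [sparsePoint]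

lemma strictMono_sparsePoint : StrictMono sparsePoint := by
  intro k l hkl
  have h1 : k ^ 2 < l ^ 2 := Nat.pow_lt_pow_left hkl two_ne_zero
  have h2 : (4 : ℝ≥0) ^ k ^ 2 < 4 ^ l ^ 2 := pow_lt_pow_right₀ (by norm_num) h1
  exact pow_lt_pow_left₀ h2 zero_le two_ne_zero

lemma lt_sparsePoint (k : ℕ) : (k : ℝ) < sparsePoint k := by
  have h1 : k < 2 ^ k := Nat.lt_two_pow_self
  have h2 : (2 : ℕ) ^ k ≤ (4 ^ k ^ 2) ^ 2 := by
    calc 2 ^ k ≤ 2 ^ (2 * (k ^ 2) * 2) := Nat.pow_le_pow_right two_pos (by nlinarith [Nat.zero_le k, Nat.le_self_pow two_ne_zero k])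
      _ = (4 ^ k ^ 2) ^ 2 := by rw [pow_mul, pow_mul]; norm_num
  rw [sparsePoint_coe]
  exact_mod_cast h1.trans_le h2

/-- Since `4^((k+1)²) = 4 * 16^k * 4^(k²)`, the next increment has a standard deviation at least
`16^k` times that of the current position. One large increment therefore outweighs all of the past.
-/
lemma sqrt_sparsePoint_sub (k : ℕ) :
    (4 : ℝ) ^ k ^ 2 * 16 ^ k ≤ √((sparsePoint (k + 1) : ℝ) - sparsePoint k) := by
  refine Real.le_sqrt_of_sq_le ?_
  rw [sparsePoint_coe, sparsePoint_coe]
  have e : (4 : ℝ) ^ (k + 1) ^ 2 = 4 ^ k ^ 2 * 16 ^ k * 4 := by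
    rw [show (k + 1) ^ 2 = k ^ 2 + 2 * k + 1 by ring, pow_add, pow_add, pow_mul]; norm_num
  have h1 : (1 : ℝ) ≤ 16 ^ k := one_le_pow₀ (by norm_num)
  have h2 : (0 : ℝ) < 4 ^ k ^ 2 := by positivity
  rw [e]
  nlinarith [mul_le_mul_of_nonneg_left h1 h2.le, mul_pos h2 (one_pos.trans_le h1)]

/-- The increments of a Brownian motion between the sparse points exceed one standard deviation
infinitely often. -/
lemma ae_frequently_large_increment {X : ℝ≥0 → Ω → ℝ} (hX : IsPreBrownianReal X P)
    (hm : ∀ t, Measurable (X t)) :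
    ∀ᵐ ω ∂P, ∃ᶠ k in atTop, √((sparsePoint (k + 1) : ℝ) - sparsePoint k) <
      X (sparsePoint (k + 1)) ω - X (sparsePoint k) ω := by
  have hprob : IsProbabilityMeasure P := hX.isGaussianProcess.isProbabilityMeasure
  set σ : ℕ → ℝ := fun k => √((sparsePoint (k + 1) : ℝ) - sparsePoint k) with hσ
  set d : ℕ → Ω → ℝ := fun k ω => X (sparsePoint (k + 1)) ω - X (sparsePoint k) ω with hd
  have hpos : ∀ k, 0 < (sparsePoint (k + 1) : ℝ) - sparsePoint k := fun k =>
    sub_pos.2 (NNReal.coe_lt_coe.2 (strictMono_sparsePoint k.lt_succ_self))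
  have hdm : ∀ k, Measurable (d k) := fun k => (hm _).sub (hm _)
  have hind : iIndepFun d P := hX.hasIndepIncrements.nat strictMono_sparsePoint.monotone
  set E : ℕ → Set Ω := fun k => d k ⁻¹' Ioi (σ k) with hE
  have hEm : ∀ k, MeasurableSet (E k) := fun k => hdm k measurableSet_Ioi
  have hEind : iIndepSet E P := (iIndepSet_iff_meas_biInter hEm).2 fun S =>
    iIndepFun_iff_measure_inter_preimage_eq_mul.1 hind S fun _ _ => measurableSet_Ioi
  -- After normalisation all these independent events have the same positive probability, so the
  -- second Borel–Cantelli lemma applies.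
  have hEp : ∀ k, P (E k) = gaussianReal 0 1 (Ioi 1) := fun k => by
    have hσ0 : 0 < σ k := Real.sqrt_pos.2 (hpos k)
    have hlaw : HasLaw (X (sparsePoint (k + 1)) - X (sparsePoint k))
        (gaussianReal 0 (nndist (sparsePoint (k + 1) : ℝ) (sparsePoint k))) P := hX.hasLaw_sub _ _
    have h1 := gaussianReal_div_const hlaw (σ k)
    have hv : nndist (sparsePoint (k + 1) : ℝ) (sparsePoint k) / NNReal.mk (σ k ^ 2) (sq_nonneg _) = 1 := by
      ext
      rw [NNReal.coe_div, NNReal.coe_mk, coe_nndist, NNReal.coe_one, Real.dist_eq, abs_of_pos (hpos k), Real.sq_sqrt (hpos k).le,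
        div_self (hpos k).ne']
    rw [zero_div, hv] at h1
    have h2 := h1.measure_eq (p := fun x => x ∈ Ioi (1 : ℝ)) measurableSet_Ioi
    refine Eq.trans (congrArg P ?_) h2
    ext ω
    simp only [hE, hd, mem_preimage, mem_Ioi, mem_ofPred_eq]
    rw [lt_div_iff₀ hσ0, one_mul]
    rfl
  have hp : gaussianReal 0 1 (Ioi 1) ≠ 0 := fun h0 => by
    have := gaussianReal_absolutelyContinuous' 0 one_ne_zero h0
    simp at this
  have hsum : ∑' k, P (E k) = ∞ := by
    simp only [hEp]
    exact ENNReal.tsum_const_eq_top_of_ne_zero hp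
  have hlim := measure_limsup_eq_one hEm hEind hsum
  have hae : ∀ᵐ ω ∂P, ω ∈ limsup E atTop :=
    (prob_compl_eq_zero_iff (MeasurableSet.measurableSet_limsup hEm)).2 hlim
  filter_upwards [hae] with ω hω
  exact mem_limsup_iff_frequently_mem.1 hω

/-- Markov's inequality gives probabilities at most `C * 2⁻ᵏ`, which are summable. -/
lemma ae_eventually_lt_of_lintegral_le {f : ℕ → Ω → ℝ≥0∞} {C : ℝ≥0∞} (hC : C ≠ ∞)
    (hf : ∀ k, AEMeasurable (f k) P) (hle : ∀ k, ∫⁻ ω, f k ω ∂P ≤ C) :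
    ∀ᵐ ω ∂P, ∀ᶠ k in atTop, f k ω < 2 ^ k := by
  have hsum : ∑' k, P {ω | 2 ^ k ≤ f k ω} ≠ ∞ := by
    have h1 : ∀ k, P {ω | 2 ^ k ≤ f k ω} ≤ C * (2⁻¹ : ℝ≥0∞) ^ k := fun k => by
      refine (meas_ge_le_lintegral_div (hf k) (by simp) (by simp)).trans ?_
      rw [div_eq_mul_inv, ENNReal.inv_pow]
      gcongr
      exact hle k
    refine ne_top_of_le_ne_top ?_ (ENNReal.tsum_le_tsum h1)
    rw [ENNReal.tsum_mul_left]
    exact ENNReal.mul_ne_top hC (by simp)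
  filter_upwards [ae_eventually_notMem hsum] with ω hω
  filter_upwards [hω] with k hk
  simpa using hk

/-- Almost every Brownian path takes values that are large compared to its roughness. -/
theorem IsRegularBrownian.ae_hasHighPoints (hB : IsRegularBrownian B P) :
    ∀ᵐ ω ∂P, HasHighPoints fun y => B y ω := by
  have hX := hB.right.toIsPreBrownianReal
  have hprob : IsProbabilityMeasure P := hX.isGaussianProcess.isProbabilityMeasure
  have h1 := ae_frequently_large_increment hX fun t => hB.measurable t
  have h2 : ∀ᵐ ω ∂P, ∀ᶠ k in atTop, roughness (fun y => B y ω) (sparsePoint k) < 2 ^ k :=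
    ae_eventually_lt_of_lintegral_le roughnessBound_ne_top
      (fun k => (hB.measurable_roughness _).aemeasurable) fun k => hB.lintegral_roughness_le _
  have h3 : ∀ᵐ ω ∂P, ∀ᶠ k in atTop,
      ENNReal.ofReal (|B (sparsePoint k) ω| / 4 ^ k ^ 2) < 2 ^ k := by
    refine ae_eventually_lt_of_lintegral_le ENNReal.one_ne_top
      (fun k => ((hB.measurable _).abs.div_const _).ennreal_ofReal.aemeasurable) fun k => ?_
    have h4 : (0 : ℝ) < 4 ^ k ^ 2 := by positivity
    simp only [div_eq_mul_inv, ENNReal.ofReal_mul (abs_nonneg _)]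
    rw [lintegral_mul_const' _ _ ENNReal.ofReal_ne_top]
    have h5 := lintegral_abs_le_of_hasLaw (hX.hasLaw_eval (sparsePoint k))
    rw [show √(sparsePoint k : ℝ) = 4 ^ k ^ 2 by rw [sparsePoint_coe, Real.sqrt_sq h4.le]] at h5
    calc _ ≤ ENNReal.ofReal (4 ^ k ^ 2) * ENNReal.ofReal (4 ^ k ^ 2)⁻¹ := by gcongr
      _ = 1 := by rw [← ENNReal.ofReal_mul h4.le, mul_inv_cancel₀ h4.ne', ENNReal.ofReal_one]
  filter_upwards [h1, h2, h3] with ω h1 h2 h3 n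
  have h2' := (tendsto_add_atTop_nat 1).eventually h2
  -- At such `k` the value at the next point exceeds `4^(k²) (16^k - 2^k)`, and the roughness there
  -- is at most `2^(k+1)`. The condition `k ≥ 3n + 1` ensures `3n ≤ 8^k - 1`, hence `n + n * 2^(k+1)
  -- ≤ 2^k (8^k - 1)`.
  obtain ⟨k, hk, h2, h3, hkn⟩ := (h1.and_eventually
    (h2'.and (h3.and (eventually_ge_atTop (3 * n + 1))))).exists
  refine ⟨sparsePoint (k + 1), ?_, (h2.trans (by simp)).ne, ?_⟩
  · refine lt_of_le_of_lt ?_ (lt_sparsePoint (k + 1))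
    exact_mod_cast (by omega : n ≤ k + 1)
  have hr : (roughness (fun y => B y ω) (sparsePoint (k + 1))).toReal ≤ 2 ^ (k + 1) := by
    have := ENNReal.toReal_mono (by simp) h2.le
    simpa using this
  have hb : |B (sparsePoint k) ω| ≤ 4 ^ k ^ 2 * 2 ^ k := by
    have h4 : (0 : ℝ) < 4 ^ k ^ 2 := by positivity
    have := (ENNReal.toReal_mono (by simp) h3.le)
    rw [ENNReal.toReal_ofReal (by positivity), div_le_iff₀ h4] at this
    simpa [mul_comm] using this
  have hs := sqrt_sparsePoint_sub k
  have hbl := neg_le_of_abs_le hb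
  have h8 : (3 * n + 1 : ℝ) < 8 ^ k - 1 := by
    have h9 : k + 1 < 8 ^ k := by
      have : k + 1 ≤ 2 ^ k := Nat.lt_two_pow_self
      calc k + 1 ≤ 2 ^ k := this
        _ < 8 ^ k := Nat.pow_lt_pow_left (by norm_num) (by omega)
    have h10 : (3 * n + 1 + 1 : ℝ) < 8 ^ k := by exact_mod_cast (by omega : 3 * n + 1 + 1 < 8 ^ k)
    linarith
  have hq : (1 : ℝ) ≤ 4 ^ k ^ 2 := one_le_pow₀ (by norm_num)
  have h2k : (1 : ℝ) ≤ 2 ^ k := one_le_pow₀ (by norm_num)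
  have h16 : (16 : ℝ) ^ k = 8 ^ k * 2 ^ k := by rw [← mul_pow]; norm_num
  have hn0 : (0 : ℝ) ≤ n := n.cast_nonneg
  have hmain : (n : ℝ) + n * 2 ^ (k + 1) ≤ 4 ^ k ^ 2 * 16 ^ k - 4 ^ k ^ 2 * 2 ^ k := by
    have e : (4 : ℝ) ^ k ^ 2 * 16 ^ k - 4 ^ k ^ 2 * 2 ^ k = 4 ^ k ^ 2 * (2 ^ k * (8 ^ k - 1)) := by
      rw [h16]; ring
    have h11 : (n : ℝ) + n * 2 ^ (k + 1) ≤ 2 ^ k * (8 ^ k - 1) := by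
      rw [pow_succ]
      nlinarith [mul_le_mul_of_nonneg_left h2k hn0]
    rw [e]
    exact h11.trans (le_mul_of_one_le_left (by nlinarith) hq)
  have := mul_le_mul_of_nonneg_left hr hn0
  linarith

end RandomHeat

/-! ### Ramp perturbations that create a triple zero form a null set. -/

namespace RandomHeat

open Filter Topology

/-- The function that increases linearly from `0` to `1` on `[i, i + 1]`. -/
noncomputable def ramp (i : Fin 3) (y : ℝ) : ℝ := max 0 (min (y - (i : ℕ)) 1)

lemma continuous_ramp (i : Fin 3) : Continuous (ramp i) := by
  unfold ramp; fun_prop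

lemma abs_ramp_le (i : Fin 3) (y : ℝ) : |ramp i y| ≤ 1 := by
  rw [abs_of_nonneg (le_max_left _ _)]
  exact max_le zero_le_one (min_le_right _ _)

lemma gaussIntegrable_one : GaussIntegrable fun _ => 1 := fun a ha => by
  simpa using integrable_exp_neg_mul_sq ha

lemma gaussIntegrable_ramp (i : Fin 3) : GaussIntegrable (ramp i) := fun a ha => by
  refine (integrable_exp_neg_mul_sq ha).mono'
    (Continuous.aestronglyMeasurable (by have := continuous_ramp i; fun_prop))
    (ae_of_all _ fun y => ?_)
  rw [norm_mul, Real.norm_eq_abs, Real.abs_exp]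
  exact mul_le_of_le_one_right (Real.exp_nonneg _) (abs_ramp_le i y)

lemma GaussIntegrable.momentX_eq_integral {b : ℝ → ℝ} (hb : GaussIntegrable b) (n : ℕ) {a : ℝ}
    (ha : 0 < a) (x : ℝ) :
    Integrable (fun y => (n * (x - y) ^ (n - 1) - 2 * a * (x - y) ^ (n + 1)) *
      Real.exp (-a * (x - y) ^ 2) * b y) ∧
    momentX b n (a, x) = ∫ y, (n * (x - y) ^ (n - 1) - 2 * a * (x - y) ^ (n + 1)) *
      Real.exp (-a * (x - y) ^ 2) * b y := by
  have h1 := (hb.integrable_moment (n - 1) ha x).const_mul (n : ℝ)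
  have h2 := (hb.integrable_moment (n + 1) ha x).const_mul (2 * a)
  have e : (fun y => (n * (x - y) ^ (n - 1) - 2 * a * (x - y) ^ (n + 1)) *
      Real.exp (-a * (x - y) ^ 2) * b y) = fun y =>
      n * ((x - y) ^ (n - 1) * Real.exp (-a * (x - y) ^ 2) * b y) -
        2 * a * ((x - y) ^ (n + 1) * Real.exp (-a * (x - y) ^ 2) * b y) := by
    ext y; ring
  rw [e]
  refine ⟨h1.sub h2, ?_⟩
  rw [integral_sub h1 h2, integral_const_mul, integral_const_mul]
  rfl

lemma hasDerivAt_pow_mul_gaussian (n : ℕ) (a x y : ℝ) :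
    HasDerivAt (fun y => (x - y) ^ n * Real.exp (-a * (x - y) ^ 2))
      (-((n * (x - y) ^ (n - 1) - 2 * a * (x - y) ^ (n + 1)) * Real.exp (-a * (x - y) ^ 2))) y := by
  have h1 : HasDerivAt (fun y => x - y) (-1) y := by simpa using (hasDerivAt_id y).const_sub x
  convert! (h1.pow n).mul ((h1.pow 2).const_mul (-a)).exp using 1
  push_cast
  simp only [Pi.pow_apply, pow_one]
  ring

/-- Integration by parts: the kernel of `momentX` is `-f'`, and the derivative of the ramp is the
indicator of `[i, i + 1]`. The boundary terms at `i + 1` cancel. -/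
lemma momentX_ramp (i : Fin 3) (n : ℕ) {a : ℝ} (ha : 0 < a) (x : ℝ) :
    momentX (ramp i) n (a, x) =
      ∫ y in (i : ℝ)..(i : ℝ) + 1, (x - y) ^ n * Real.exp (-a * (x - y) ^ 2) := by
  obtain ⟨hint, hmom⟩ := (gaussIntegrable_ramp i).momentX_eq_integral n ha x
  obtain ⟨hint1, -⟩ := gaussIntegrable_one.momentX_eq_integral n ha x
  have hf1 := gaussIntegrable_one.integrable_moment n ha x
  simp only [mul_one] at hint1 hf1
  set f : ℝ → ℝ := fun y => (x - y) ^ n * Real.exp (-a * (x - y) ^ 2) with hf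
  set g : ℝ → ℝ := fun y => (n * (x - y) ^ (n - 1) - 2 * a * (x - y) ^ (n + 1)) *
    Real.exp (-a * (x - y) ^ 2) with hg
  have hd : ∀ y, HasDerivAt f (-g y) y := hasDerivAt_pow_mul_gaussian n a x
  have hd' : ∀ y, HasDerivAt (fun y => -f y) (g y) y := fun y => by
    simpa using! (hd y).neg
  have hgc : Continuous g := by fun_prop
  have hfc : Continuous f := by fun_prop
  set c : ℝ := (i : ℝ) with hc
  have hzero : ∀ y ∉ Ioi c, g y * ramp i y = 0 := fun y hy => by
    have h1 : y ≤ c := not_lt.1 hy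
    have h2 : ramp i y = 0 :=
      max_eq_left ((min_le_left _ _).trans (sub_nonpos.2 h1))
    rw [h2, mul_zero]
  have e1 : ∫ y in Ioc c (c + 1), g y * ramp i y = (∫ y in c..c + 1, f y) - f (c + 1) := by
    have h1 : ∫ y in Ioc c (c + 1), g y * ramp i y = ∫ y in c..c + 1, (y - c) * g y := by
      rw [intervalIntegral.integral_of_le (by linarith)]
      refine setIntegral_congr_fun measurableSet_Ioc fun y hy => ?_
      have h2 : ramp i y = y - c := by
        rw [ramp, min_eq_left (by linarith [hy.2]), max_eq_right (by linarith [hy.1])]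
      simp only [h2, mul_comm]
    have h3 := intervalIntegral.integral_mul_deriv_eq_deriv_mul (a := c) (b := c + 1)
      (u := fun y => y - c) (v := fun y => -f y) (u' := fun _ => 1) (v' := g)
      (fun y _ => by simpa using (hasDerivAt_id y).sub_const c)
      (fun y _ => hd' y) (by simp) (hgc.intervalIntegrable _ _)
    rw [h1, h3]
    simp
    ring
  have e2 : ∫ y in Ioi (c + 1), g y * ramp i y = f (c + 1) := by
    have h1 : ∫ y in Ioi (c + 1), g y * ramp i y = ∫ y in Ioi (c + 1), g y := by
      refine setIntegral_congr_fun measurableSet_Ioi fun y hy => ?_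
      have hy' : c + 1 < y := hy
      have h2 : ramp i y = 1 := by
        rw [ramp, min_eq_right (by linarith), max_eq_right zero_le_one]
      simp only [h2, mul_one]
    have hlim : Tendsto f atTop (𝓝 0) :=
      tendsto_zero_of_hasDerivAt_of_integrableOn_Ioi (a := c) (fun y _ => hd y)
        hint1.neg.integrableOn hf1.integrableOn
    have h3 := integral_Ioi_of_hasDerivAt_of_tendsto' (a := c + 1) (f := fun y => -f y) (f' := g)
      (m := 0) (fun y _ => hd' y) hint1.integrableOn (by simpa using hlim.neg)
    rw [h1, h3]
    ring
  rw [hmom]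
  change ∫ y, g y * ramp i y = _
  rw [← setIntegral_eq_integral_of_forall_compl_eq_zero hzero,
    ← Ioc_union_Ioi_eq_Ioi (show c ≤ c + 1 by linarith),
    setIntegral_union (Ioc_disjoint_Ioi le_rfl) measurableSet_Ioi hint.integrableOn
      hint.integrableOn, e1, e2]
  ring

/-- The matrix `(momentX (ramp i) n)`, `n, i ≤ 2`. -/
noncomputable def rampMatrix (p : ℝ × ℝ) : Matrix (Fin 3) (Fin 3) ℝ :=
  Matrix.of fun n i => momentX (ramp i) n p

lemma exists_zero_of_integral_eq_zero {f : ℝ → ℝ} (hf : Continuous f) {a b : ℝ} (hab : a < b)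
    (h : ∫ y in a..b, f y = 0) : ∃ y ∈ Ioo a b, f y = 0 := by
  have hd : ∀ y, HasDerivAt (fun y => ∫ z in a..y, f z) (f y) y := fun y =>
    intervalIntegral.integral_hasDerivAt_right (hf.intervalIntegrable _ _)
      (hf.stronglyMeasurableAtFilter _ _) hf.continuousAt
  exact exists_hasDerivAt_eq_zero hab (fun y _ => (hd y).continuousAt.continuousWithinAt)
    (by simp [h]) fun y _ => hd y

/-- A vector `c` in the left kernel makes `∑ c n (x - y)^n`, against a positive weight, integrate to
zero over three disjoint intervals. This polynomial of degree at most two then has three distinct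
roots, so `c = 0` by Vandermonde. -/
lemma det_rampMatrix_ne_zero {p : ℝ × ℝ} (hp : 0 < p.1) : (rampMatrix p).det ≠ 0 := by
  obtain ⟨a, x⟩ := p
  intro h0
  obtain ⟨c, hc, hcA⟩ := Matrix.exists_vecMul_eq_zero_iff.2 h0
  have hroot : ∀ i : Fin 3, ∃ y ∈ Ioo (i : ℝ) ((i : ℝ) + 1),
      ∑ n : Fin 3, c n * (x - y) ^ (n : ℕ) = 0 := by
    intro i
    have h1 := congrFun hcA i
    simp only [Matrix.vecMul, dotProduct, rampMatrix, Matrix.of_apply, Pi.zero_apply,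
      momentX_ramp i _ hp] at h1
    simp only [← intervalIntegral.integral_const_mul] at h1
    rw [← intervalIntegral.integral_finsetSum fun n _ =>
      Continuous.intervalIntegrable (by fun_prop) _ _] at h1
    obtain ⟨y, hy, hy0⟩ := exists_zero_of_integral_eq_zero (by fun_prop) (by linarith) h1
    refine ⟨y, hy, ?_⟩
    simp only [← mul_assoc, ← Finset.sum_mul] at hy0
    exact (mul_eq_zero.1 hy0).resolve_right (Real.exp_ne_zero _)
  choose y hy hy0 using hroot
  have hinj : Function.Injective fun i => x - y i := by
    intro i j hij
    have hij' : y i = y j := by simpa using hij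
    have h1 := hy i
    have h2 := hy j
    rw [hij'] at h1
    have h3 : ((i : ℕ) : ℝ) < ((j : ℕ) : ℝ) + 1 := h1.1.trans h2.2
    have h4 : ((j : ℕ) : ℝ) < ((i : ℕ) : ℝ) + 1 := h2.1.trans h1.2
    norm_cast at h3 h4
    omega
  refine hc (Matrix.eq_zero_of_mulVec_eq_zero (Matrix.det_vandermonde_ne_zero_iff.2 hinj) ?_)
  ext i
  simpa [Matrix.mulVec, dotProduct, Matrix.vandermonde_apply, mul_comm] using hy0 i

/-- The values of `z` for which the path `g + ∑ i, z i • ramp i` has a triple zero. -/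
def tripleZeroParams (g : ℝ → ℝ) : Set (Fin 3 → ℝ) :=
  {z | ∃ p : ℝ × ℝ, 0 < p.1 ∧ ∀ n : Fin 3, momentX g n p + (rampMatrix p).mulVec z n = 0}

lemma GaussIntegrable.differentiableAt_momentX {b : ℝ → ℝ} (hb : GaussIntegrable b) (n : ℕ)
    {p : ℝ × ℝ} (hp : 0 < p.1) : DifferentiableAt ℝ (momentX b n) p := by
  have h1 := (hb.hasFDerivAt_moment (n - 1) hp).differentiableAt
  have h2 := (hb.hasFDerivAt_moment (n + 1) hp).differentiableAt
  unfold momentX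
  fun_prop

lemma differentiableAt_det {E : Type*} [NormedAddCommGroup E] [NormedSpace ℝ E]
    {M : E → Matrix (Fin 3) (Fin 3) ℝ} {v : E} (h : ∀ i j, DifferentiableAt ℝ (fun v => M v i j) v) :
    DifferentiableAt ℝ (fun v => (M v).det) v := by
  simp only [Matrix.det_fin_three]
  fun_prop

/-- For each `(a, x)` exactly one `z` solves the linear system. The half-plane of parameters is
embedded as a null subset of `ℝ³`, because differentiable maps between spaces of equal dimension
preserve null sets. -/
lemma volume_tripleZeroParams {g : ℝ → ℝ} (hg : GaussIntegrable g) :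
    volume (tripleZeroParams g) = 0 := by
  set π : (Fin 3 → ℝ) → ℝ × ℝ := fun v => (v 0, v 1) with hπ
  set w : (Fin 3 → ℝ) → Fin 3 → ℝ := fun v n => -momentX g n (π v) with hw
  -- Cramer's rule for the solution `z`, which reduces differentiability to that of the matrix
  -- entries.
  set f : (Fin 3 → ℝ) → Fin 3 → ℝ := fun v i =>
    (rampMatrix (π v)).det⁻¹ * ((rampMatrix (π v)).updateCol i (w v)).det with hf
  set s : Set (Fin 3 → ℝ) := {v | 0 < v 0 ∧ v 2 = 0} with hs
  have hs0 : volume s = 0 := by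
    refine measure_mono_null (t := {v | v 2 = 0}) (fun v hv => hv.2) ?_
    exact Measure.pi_hyperplane (fun _ : Fin 3 => (volume : Measure ℝ)) 2 0
  have hdiff : DifferentiableOn ℝ f s := by
    intro v hv
    refine DifferentiableAt.differentiableWithinAt (differentiableAt_pi.2 fun i => ?_)
    have hπd : DifferentiableAt ℝ π v := by fun_prop
    have hM : ∀ (b : ℝ → ℝ) (n : ℕ), GaussIntegrable b →
        DifferentiableAt ℝ (fun v => momentX b n (π v)) v := fun b n hb =>
      DifferentiableAt.comp (g := momentX b n) v (hb.differentiableAt_momentX n hv.1) hπd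
    refine DifferentiableAt.mul (DifferentiableAt.inv (differentiableAt_det fun n j =>
      hM _ n (gaussIntegrable_ramp j)) (det_rampMatrix_ne_zero hv.1)) (differentiableAt_det ?_)
    intro n j
    by_cases hij : j = i
    · simp only [hij, Matrix.updateCol_self]
      exact (hM g n hg).neg
    · simp only [Matrix.updateCol_ne hij]
      exact hM _ n (gaussIntegrable_ramp j)
  refine measure_mono_null ?_
    (addHaar_image_eq_zero_of_differentiableOn_of_addHaar_eq_zero volume hdiff hs0)
  rintro z ⟨⟨a, x⟩, ha, hz⟩
  refine ⟨![a, x, 0], ⟨by simpa using ha, by simp⟩, ?_⟩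
  have hπv : π ![a, x, 0] = (a, x) := by simp [hπ]
  have hwz : w ![a, x, 0] = (rampMatrix (a, x)).mulVec z := by
    ext n
    simp only [hw, hπv]
    linarith [hz n]
  ext i
  simp only [hf]
  rw [hwz, hπv, ← Matrix.cramer_apply, Matrix.cramer_eq_adjugate_mulVec, Matrix.mulVec_mulVec,
    Matrix.adjugate_mul, Matrix.smul_mulVec, Matrix.one_mulVec, Pi.smul_apply, smul_eq_mul,
    inv_mul_cancel_left₀ (det_rampMatrix_ne_zero ha)]

end RandomHeat

/-! ### Independence of the unit increments from the residual path. -/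

namespace RandomHeat

open Filter Topology
open scoped ENNReal

section

variable {Ω : Type*} [MeasurableSpace Ω] {P : Measure Ω} {B : ℝ → Ω → ℝ}

theorem isGaussianProcess_sumElim_of_indepFun {S T : Type*} {X : S → Ω → ℝ} {Y : T → Ω → ℝ}
    (hX : IsGaussianProcess X P) (hY : IsGaussianProcess Y P)
    (h : IndepFun (fun ω s => X s ω) (fun ω t => Y t ω) P) :
    IsGaussianProcess (Sum.elim X Y) P where
  hasGaussianLaw I := by
    have h' : IndepFun (fun ω => I.toLeft.restrict (X · ω)) (fun ω => I.toRight.restrict (Y · ω)) P :=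
      h.comp (Finset.measurable_restrict I.toLeft) (Finset.measurable_restrict I.toRight)
    have hG := h'.hasGaussianLaw (hX.hasGaussianLaw I.toLeft) (hY.hasGaussianLaw I.toRight)
    let L : (I.toLeft → ℝ) × (I.toRight → ℝ) →L[ℝ] (I → ℝ) :=
      ContinuousLinearMap.pi fun s => match s with
        | ⟨.inl a, ha⟩ => (ContinuousLinearMap.proj ⟨a, Finset.mem_toLeft.2 ha⟩).comp
            (ContinuousLinearMap.fst ℝ _ _)
        | ⟨.inr a, ha⟩ => (ContinuousLinearMap.proj ⟨a, Finset.mem_toRight.2 ha⟩).comp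
            (ContinuousLinearMap.snd ℝ _ _)
    convert! hG.map L using 1
    ext ω ⟨s, hs⟩
    cases s <;> rfl

theorem IsTwoSidedBrownian.isGaussianProcess (hB : IsTwoSidedBrownian B P) :
    IsGaussianProcess B P := by
  have h := (isGaussianProcess_sumElim_of_indepFun hB.right.isGaussianProcess
    hB.left.isGaussianProcess hB.indep).comp_right
      (fun s : ℝ => if 0 ≤ s then Sum.inl s.toNNReal else Sum.inr (-s).toNNReal)
  convert! h using 1
  ext s ω
  by_cases hs : 0 ≤ s
  · simp [hs]
  · simp [hs, (not_le.1 hs).le]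

/-- The increment over `[i, i + 1]`. -/
def unitIncrement (B : ℝ → Ω → ℝ) (i : Fin 3) (ω : Ω) : ℝ := B ((i : ℕ) + 1) ω - B (i : ℕ) ω

/-- The component of the path that is independent of the three unit increments. -/
noncomputable def rampResidual (B : ℝ → Ω → ℝ) (y : ℝ) (ω : Ω) : ℝ :=
  B y ω - ∑ i, ramp i y * unitIncrement B i ω

lemma IsTwoSidedBrownian.memLp_two (hB : IsTwoSidedBrownian B P) (y : ℝ) : MemLp (B y) 2 P :=
  (hB.isGaussianProcess.hasGaussianLaw_eval y).memLp_two

lemma IsTwoSidedBrownian.memLp_unitIncrement (hB : IsTwoSidedBrownian B P) (i : Fin 3) :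
    MemLp (unitIncrement B i) 2 P :=
  (hB.memLp_two _).sub (hB.memLp_two _)

/-- For `y ≥ 0` the covariance is `min y (i + 1) - min y i`; for `y < 0` it vanishes by independence
of the two halves. Subtracting ramps is thus the orthogonal projection off the increments. -/
lemma IsTwoSidedBrownian.covariance_unitIncrement [IsProbabilityMeasure P]
    (hB : IsTwoSidedBrownian B P) (i : Fin 3)
    (y : ℝ) : cov[B y, unitIncrement B i; P] = ramp i y := by
  have e : unitIncrement B i = B ((i : ℕ) + 1) - B (i : ℕ) := rfl
  rw [e, covariance_sub_right (hB.memLp_two _) (hB.memLp_two _) (hB.memLp_two _)]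
  rcases le_or_gt 0 y with hy | hy
  · lift y to ℝ≥0 using hy
    have h1 := hB.right.covariance_eval y ((i : ℕ) + 1)
    have h2 := hB.right.covariance_eval y (i : ℕ)
    push_cast at h1 h2
    rw [h1, h2, ramp]
    grind
  · have key : ∀ z : ℝ≥0, cov[B y, B z; P] = 0 := fun z => by
      have h1 := hB.indep.comp (measurable_pi_apply z) (measurable_pi_apply (-y).toNNReal)
      have h2 := h1.symm.covariance_eq_zero
      simp only [Function.comp_def] at h2
      rw [Real.coe_toNNReal _ (by linarith), neg_neg] at h2
      exact h2 (hB.memLp_two y) (hB.memLp_two z)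
    have h1 := key ((i : ℕ) + 1)
    have h2 := key (i : ℕ)
    push_cast at h1 h2
    rw [h1, h2, ramp]
    have : (0 : ℝ) ≤ (i : ℕ) := Nat.cast_nonneg _
    grind

lemma ramp_succ_sub (i j : Fin 3) :
    ramp i ((j : ℕ) + 1) - ramp i (j : ℕ) = if i = j then 1 else 0 := by
  fin_cases i <;> fin_cases j <;> simp [ramp] <;> norm_num

lemma IsTwoSidedBrownian.covariance_rampResidual [IsProbabilityMeasure P]
    (hB : IsTwoSidedBrownian B P) (y : ℝ)
    (i : Fin 3) : cov[rampResidual B y, unitIncrement B i; P] = 0 := by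
  have hZ := hB.memLp_unitIncrement
  have e : rampResidual B y = B y - ∑ j, fun ω => ramp j y * unitIncrement B j ω := by
    ext ω; simp [rampResidual]
  have hs : ∀ j ∈ Finset.univ, MemLp (fun ω => ramp j y * unitIncrement B j ω) 2 P := fun j _ =>
    (hZ j).const_mul _
  rw [e, covariance_sub_left (hB.memLp_two _) (memLp_finsetSum' _ hs) (hZ i),
    covariance_sum_left' hs (hZ i), hB.covariance_unitIncrement]
  have : ∀ j, cov[fun ω => ramp j y * unitIncrement B j ω, unitIncrement B i; P] =
      if i = j then ramp j y else 0 := fun j => by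
    have e : unitIncrement B j = B ((j : ℕ) + 1) - B (j : ℕ) := rfl
    rw [covariance_const_mul_left, e,
      covariance_sub_left (hB.memLp_two _) (hB.memLp_two _) (hZ i),
      hB.covariance_unitIncrement, hB.covariance_unitIncrement, ramp_succ_sub]
    split_ifs <;> simp
  simp [this]

/-- Uncorrelated jointly Gaussian families are independent; joint Gaussianity holds because
everything is linear in finitely many values of `B`, those at `y`, `0`, `1`, `2`, `3`. -/
theorem IsTwoSidedBrownian.indepFun_rampResidual [IsProbabilityMeasure P]
    (hB : IsTwoSidedBrownian B P) :
    IndepFun (fun ω y => rampResidual B y ω) (fun ω i => unitIncrement B i ω) P := by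
  have hZ := hB.memLp_unitIncrement
  refine IsGaussianProcess.indepFun_of_covariance_eq_zero ?_ (fun y => ?_)
    (fun i => (hZ i).aestronglyMeasurable.aemeasurable) hB.covariance_rampResidual
  · have hmem : ∀ i : Fin 3, ((i : ℕ) : ℝ) ∈ (Finset.range 4).image (Nat.cast : ℕ → ℝ) ∧
        ((i : ℕ) : ℝ) + 1 ∈ (Finset.range 4).image (Nat.cast : ℕ → ℝ) := fun i =>
      ⟨Finset.mem_image_of_mem _ (Finset.mem_range.2 (by omega)),
        Finset.mem_image.2 ⟨(i : ℕ) + 1, Finset.mem_range.2 (by omega), by push_cast; rfl⟩⟩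
    refine hB.isGaussianProcess.of_isGaussianProcess fun s => ?_
    rcases s with y | i
    · refine ⟨insert y ((Finset.range 4).image (Nat.cast : ℕ → ℝ)),
        ContinuousLinearMap.proj ⟨y, Finset.mem_insert_self _ _⟩ - ∑ i : Fin 3, ramp i y •
          (ContinuousLinearMap.proj ⟨_, Finset.mem_insert_of_mem (hmem i).2⟩ -
            ContinuousLinearMap.proj ⟨_, Finset.mem_insert_of_mem (hmem i).1⟩), fun ω => ?_⟩
      simp [rampResidual, unitIncrement]
    · exact ⟨_, ContinuousLinearMap.proj ⟨_, (hmem i).2⟩ - ContinuousLinearMap.proj ⟨_, (hmem i).1⟩,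
        fun ω => by simp [unitIncrement]⟩
  · exact (hB.aemeasurable y).sub (Finset.aemeasurable_fun_sum _ fun i _ =>
      ((hZ i).aestronglyMeasurable.aemeasurable.const_mul _))

theorem IsTwoSidedBrownian.hasLaw_unitIncrement (hB : IsTwoSidedBrownian B P) :
    HasLaw (fun ω i => unitIncrement B i ω) (Measure.pi fun _ : Fin 3 => gaussianReal 0 1) P := by
  have := hB.isGaussianProcess.isProbabilityMeasure
  have hi := hB.right.hasIndepIncrements 3 (fun i : Fin 4 => ((i : ℕ) : ℝ≥0))
    (fun i j hij => by simpa using hij)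
  have hl : ∀ i : Fin 3, HasLaw (unitIncrement B i) (gaussianReal 0 1) P := fun i => by
    have h := hB.right.hasLaw_sub ((i : ℕ) + 1) (i : ℕ)
    have e : nndist (((i : ℕ) : ℝ≥0) + 1).1 ((i : ℕ) : ℝ≥0).1 = 1 := by
      ext; simp
    rw [e] at h
    convert! h using 1
  refine iIndepFun.hasLaw_pi hl ?_
  convert! hi using 1
  ext i ω; simp [unitIncrement]

/-- The density is at most `1 / √(2π) < 1`. Domination of measures passes directly to products, and
this yields absolute continuity in `ℝ³`. -/
lemma gaussianReal_zero_one_le_volume : gaussianReal 0 1 ≤ volume := by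
  rw [gaussianReal_of_var_ne_zero _ one_ne_zero]
  refine (withDensity_mono (g := 1) (ae_of_all _ fun x => ?_)).trans_eq withDensity_one
  rw [gaussianPDF, Pi.one_apply, ENNReal.ofReal_le_one, gaussianPDFReal]
  have h1 : (1 : ℝ) ≤ √(2 * Real.pi * (1 : ℝ≥0)) := by
    rw [Real.one_le_sqrt, NNReal.coe_one]; linarith [Real.pi_gt_three]
  refine mul_le_one₀ (inv_le_one_of_one_le₀ h1) (Real.exp_nonneg _) (Real.exp_le_one_iff.2 ?_)
  exact div_nonpos_of_nonpos_of_nonneg (neg_nonpos.2 (sq_nonneg _)) (by simp)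

lemma pi_mono {ι : Type*} [Fintype ι] {μ ν : ι → Measure ℝ} [∀ i, SigmaFinite (μ i)]
    [∀ i, SigmaFinite (ν i)] (h : ∀ i, μ i ≤ ν i) : Measure.pi μ ≤ Measure.pi ν := by
  refine Measure.le_iff'.2 fun s => ?_
  have h1 : (Measure.pi μ).toOuterMeasure ≤ OuterMeasure.pi fun i => (ν i).toOuterMeasure := by
    refine OuterMeasure.le_pi.2 fun t _ => ?_
    rw [Measure.coe_toOuterMeasure, Measure.pi_pi]
    exact Finset.prod_le_prod' fun i _ => h i _
  refine (h1 s).trans ?_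
  rw [Measure.pi]
  exact le_toMeasure_apply _ _ _

theorem IsTwoSidedBrownian.map_unitIncrement_absolutelyContinuous
    (hB : IsTwoSidedBrownian B P) :
    P.map (fun ω i => unitIncrement B i ω) ≪ volume := by
  rw [hB.hasLaw_unitIncrement.map_eq]
  exact (pi_mono fun _ => gaussianReal_zero_one_le_volume).absolutelyContinuous

end

end RandomHeat

/-! ### Almost sure absence of triple zeros, by Fubini. -/

namespace RandomHeat

open Filter Topology
open scoped ENNReal

lemma GaussIntegrable.sub_ramp {b : ℝ → ℝ} (hb : GaussIntegrable b) (z : Fin 3 → ℝ) :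
    GaussIntegrable fun y => b y - ∑ i, ramp i y * z i := fun a ha => by
  have h := (hb a ha).sub (integrable_finsetSum Finset.univ fun i _ =>
    (gaussIntegrable_ramp i a ha).mul_const (z i))
  refine h.congr (ae_of_all _ fun y => ?_)
  simp only [Pi.sub_apply, mul_sub, Finset.mul_sum, mul_assoc]

lemma GaussIntegrable.momentX_sub_ramp {b : ℝ → ℝ} (hb : GaussIntegrable b) (z : Fin 3 → ℝ)
    (n : Fin 3) {p : ℝ × ℝ} (hp : 0 < p.1) :
    momentX (fun y => b y - ∑ i, ramp i y * z i) n p =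
      momentX b n p - (rampMatrix p).mulVec z n := by
  obtain ⟨a, x⟩ := p
  obtain ⟨h1, e1⟩ := hb.momentX_eq_integral n hp x
  have hr := fun i => (gaussIntegrable_ramp i).momentX_eq_integral n hp x
  have hs := fun i => (hr i).1.mul_const (z i)
  rw [((hb.sub_ramp z).momentX_eq_integral n hp x).2, e1, Matrix.mulVec, dotProduct]
  simp only [rampMatrix, Matrix.of_apply, fun i => (hr i).2, ← integral_mul_const]
  rw [← integral_finsetSum _ fun i _ => hs i,
    ← integral_sub h1 (integrable_finsetSum _ fun i _ => hs i)]
  congr 1 with y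
  simp only [mul_sub, Finset.mul_sum, mul_assoc]

/-- The size of the three moment derivatives of `g` plus the ramps with heights `z`. -/
noncomputable def tripleZeroDefect (g : ℝ → ℝ) (z : Fin 3 → ℝ) (p : ℝ × ℝ) : ℝ :=
  ∑ n : Fin 3, |momentX g n p + (rampMatrix p).mulVec z n|

lemma tripleZeroDefect_eq_zero_iff {g : ℝ → ℝ} {z : Fin 3 → ℝ} {p : ℝ × ℝ} :
    tripleZeroDefect g z p = 0 ↔ ∀ n : Fin 3, momentX g n p + (rampMatrix p).mulVec z n = 0 := by
  simp [tripleZeroDefect, Finset.sum_eq_zero_iff_of_nonneg]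

lemma continuousAt_tripleZeroDefect {g : ℝ → ℝ} (hg : GaussIntegrable g) (z : Fin 3 → ℝ)
    {p : ℝ × ℝ} (hp : 0 < p.1) : ContinuousAt (tripleZeroDefect g z) p := by
  have h1 := fun n : Fin 3 => (hg.differentiableAt_momentX n hp).continuousAt
  have h2 := fun n i : Fin 3 =>
    ((gaussIntegrable_ramp i).differentiableAt_momentX n hp).continuousAt
  unfold tripleZeroDefect
  simp only [Matrix.mulVec, dotProduct, rampMatrix, Matrix.of_apply]
  fun_prop

/-- The `k`-th set in a compact exhaustion of the half-plane. -/
def paramBox (k : ℕ) : Set (ℝ × ℝ) := Icc (1 / ((k : ℝ) + 1)) (k + 1) ×ˢ Icc (-(k : ℝ)) k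

lemma fst_pos_of_mem_paramBox {k : ℕ} {p : ℝ × ℝ} (hp : p ∈ paramBox k) : 0 < p.1 :=
  lt_of_lt_of_le (by positivity) hp.1.1

lemma exists_paramBox_mem_nhds {p : ℝ × ℝ} (hp : 0 < p.1) : ∃ k, paramBox k ∈ 𝓝 p := by
  obtain ⟨k, hk⟩ := exists_nat_gt (max (max p.1 p.1⁻¹) |p.2|)
  obtain ⟨⟨h1, h2⟩, h3⟩ := by simpa only [max_lt_iff] using hk
  refine ⟨k, prod_mem_nhds (Icc_mem_nhds ?_ (by linarith)) (Icc_mem_nhds ?_ (lt_of_abs_lt h3))⟩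
  · rw [one_div]
    exact inv_lt_of_inv_lt₀ hp (by linarith)
  · exact neg_lt_of_abs_lt h3

/-- A rational point of the plane. -/
def ratPoint (q : ℚ × ℚ) : ℝ × ℝ := Prod.map (Rat.cast : ℚ → ℝ) (Rat.cast : ℚ → ℝ) q

lemma denseRange_ratPoint : DenseRange ratPoint :=
  Rat.denseRange_cast.prodMap Rat.denseRange_cast

/-- Values of the moment derivatives at the rational points, together with ramp heights, for which
the defect comes arbitrarily close to zero in a box. -/
def nearTripleZeros (k : ℕ) : Set ((ℚ × ℚ → Fin 3 → ℝ) × (Fin 3 → ℝ)) :=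
  ⋂ m : ℕ, ⋃ q : ℚ × ℚ, {w | ratPoint q ∈ paramBox k ∧
    ∑ n : Fin 3, |w.1 q n + (rampMatrix (ratPoint q)).mulVec w.2 n| < 1 / ((m : ℝ) + 1)}

lemma measurableSet_nearTripleZeros (k : ℕ) : MeasurableSet (nearTripleZeros k) := by
  refine MeasurableSet.iInter fun m => MeasurableSet.iUnion fun q => ?_
  rw [Set.ofPred_and]
  refine (MeasurableSet.const _).inter (measurableSet_lt ?_ measurable_const)
  simp only [Matrix.mulVec, dotProduct]
  fun_prop

/-- The moment derivatives of `g` at the rational points. -/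
noncomputable def ratMoments (g : ℝ → ℝ) (q : ℚ × ℚ) (n : Fin 3) : ℝ := momentX g n (ratPoint q)

/-- Existence of a triple zero is an uncountable union of events; `nearTripleZeros` replaces it by
countable operations. A continuous defect with infimum `0` on a compact box vanishes somewhere in
it; conversely, rational points near a zero have small defect (`mem_nearTripleZeros`). -/
lemma mem_tripleZeroParams_of_nearTripleZeros {g : ℝ → ℝ} (hg : GaussIntegrable g) {k : ℕ}
    {z : Fin 3 → ℝ} (hz : (ratMoments g, z) ∈ nearTripleZeros k) : z ∈ tripleZeroParams g := by
  simp only [nearTripleZeros, mem_iInter, mem_iUnion] at hz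
  choose q hq hlt using hz
  obtain ⟨p, hp, hmin⟩ := (isCompact_Icc.prod isCompact_Icc : IsCompact (paramBox k)).exists_isMinOn
    ⟨_, hq 0⟩ (f := tripleZeroDefect g z) fun p hp =>
      (continuousAt_tripleZeroDefect hg z (fst_pos_of_mem_paramBox hp)).continuousWithinAt
  refine ⟨p, fst_pos_of_mem_paramBox hp, tripleZeroDefect_eq_zero_iff.1 (le_antisymm ?_
    (Finset.sum_nonneg fun _ _ => abs_nonneg _))⟩
  exact ge_of_tendsto' tendsto_one_div_add_atTop_nhds_zero_nat fun m =>
    (hmin (hq m)).trans (hlt m).le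

lemma mem_nearTripleZeros {g : ℝ → ℝ} (hg : GaussIntegrable g) {z : Fin 3 → ℝ} {p : ℝ × ℝ}
    (hp : 0 < p.1) (h0 : tripleZeroDefect g z p = 0) {k : ℕ} (hk : paramBox k ∈ 𝓝 p) :
    (ratMoments g, z) ∈ nearTripleZeros k := by
  simp only [nearTripleZeros, mem_iInter, mem_iUnion]
  intro m
  have h := (continuousAt_tripleZeroDefect hg z hp).eventually_lt_const
    (show tripleZeroDefect g z p < 1 / ((m : ℝ) + 1) by rw [h0]; positivity)
  exact denseRange_ratPoint.mem_nhds (Filter.inter_mem hk h)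

lemma measurable_ratMoments {Ω : Type*} [MeasurableSpace Ω] {R : ℝ → Ω → ℝ}
    (hc : ∀ ω, Continuous fun y => R y ω) (hm : ∀ y, Measurable (R y)) :
    Measurable fun ω => ratMoments fun y => R y ω := by
  have h : Measurable fun w : Ω × ℝ => R w.2 w.1 :=
    (measurable_uncurry_of_continuous_of_measurable (u := R) hc hm).comp measurable_swap
  have hmom : ∀ (n : ℕ) (p : ℝ × ℝ), Measurable fun ω => moment (fun y => R y ω) n p :=
    fun n p => (StronglyMeasurable.integral_prod_right (ν := volume)
      (f := fun ω y => (p.2 - y) ^ n * Real.exp (-p.1 * (p.2 - y) ^ 2) * R y ω)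
      (Measurable.stronglyMeasurable (((by fun_prop : Measurable fun w : Ω × ℝ =>
        (p.2 - w.2) ^ n * Real.exp (-p.1 * (p.2 - w.2) ^ 2))).mul h))).measurable
  refine measurable_pi_lambda _ fun q => measurable_pi_lambda _ fun n => ?_
  exact ((hmom _ _).const_mul _).sub ((hmom _ _).const_mul _)

section

variable {Ω : Type*} [MeasurableSpace Ω] {P : Measure Ω} {B : ℝ → Ω → ℝ}

lemma IsRegularBrownian.measurable_rampResidual (hB : IsRegularBrownian B P) (y : ℝ) :
    Measurable (rampResidual B y) := by
  have := hB.measurable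
  unfold rampResidual unitIncrement
  fun_prop

lemma IsRegularBrownian.continuous_rampResidual (hB : IsRegularBrownian B P) (ω : Ω) :
    Continuous fun y => rampResidual B y ω := by
  have := hB.continuous ω
  have := continuous_ramp
  unfold rampResidual
  fun_prop

lemma IsRegularBrownian.indepFun_ratMoments [IsProbabilityMeasure P]
    (hB : IsRegularBrownian B P) :
    IndepFun (fun ω => ratMoments fun y => rampResidual B y ω)
      (fun ω i => unitIncrement B i ω) P := by
  have h := hB.indepFun_rampResidual
  rw [IndepFun_iff_Indep] at h ⊢
  refine indep_of_indep_of_le_left h (Measurable.comap_le ?_)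
  -- Here `Ω` carries the σ-algebra generated by the residual process, so the moments inherit its
  -- independence from the increments.
  refine @measurable_ratMoments Ω (MeasurableSpace.comap _ _) _ hB.continuous_rampResidual
    fun y => ?_
  exact (measurable_pi_apply y).comp (comap_measurable fun ω y => rampResidual B y ω)

/-- The path is its residual plus ramps with the unit increments as heights. With the residual
frozen, these heights have an absolutely continuous law, which does not charge the null set of bad
heights. -/
theorem IsRegularBrownian.ae_exists_momentX_ne_zero [IsProbabilityMeasure P]
    (hB : IsRegularBrownian B P) :
    ∀ᵐ ω ∂P, ∀ a x : ℝ, 0 < a → ∃ n : Fin 3, momentX (fun y => B y ω) n (a, x) ≠ 0 := by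
  have hG : ∀ᵐ ω ∂P, GaussIntegrable fun y => B y ω :=
    (hB.ae_roughness_ne_top 0).mono fun ω h => gaussIntegrable_of_roughness (hB.continuous ω) h
  have hΓ : Measurable fun ω => ratMoments fun y => rampResidual B y ω :=
    measurable_ratMoments hB.continuous_rampResidual hB.measurable_rampResidual
  have hZ : Measurable fun ω i => unitIncrement B i ω := by
    have := hB.measurable
    unfold unitIncrement
    fun_prop
  have hnull : ∀ᵐ ω ∂P, ∀ k, (ratMoments fun y => rampResidual B y ω,
      fun i => unitIncrement B i ω) ∉ nearTripleZeros k := by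
    rw [ae_all_iff]
    intro k
    have hN := measurableSet_nearTripleZeros k
    have h := (indepFun_iff_map_prod_eq_prod_map_map hΓ.aemeasurable hZ.aemeasurable).1
      hB.indepFun_ratMoments
    have h0 : P.map (fun ω => (ratMoments fun y => rampResidual B y ω,
        fun i => unitIncrement B i ω)) (nearTripleZeros k) = 0 := by
      have := Measure.isProbabilityMeasure_map (μ := P) hZ.aemeasurable
      rw [h, Measure.measure_prod_null hN]
      refine (ae_map_iff hΓ.aemeasurable
        (measurable_measure_prodMk_left hN (measurableSet_singleton 0))).2 ?_
      filter_upwards [hG] with ω hω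
      refine hB.map_unitIncrement_absolutelyContinuous (measure_mono_null (fun z hz => ?_)
        (volume_tripleZeroParams (hω.sub_ramp fun i => unitIncrement B i ω)))
      exact mem_tripleZeroParams_of_nearTripleZeros (hω.sub_ramp _) hz
    exact measure_eq_zero_iff_ae_notMem.1 (by rwa [Measure.map_apply (hΓ.prodMk hZ) hN] at h0)
  filter_upwards [hG, hnull] with ω hω hn a x ha
  by_contra! hcon
  obtain ⟨k, hk⟩ := exists_paramBox_mem_nhds (p := (a, x)) ha
  refine hn k (mem_nearTripleZeros (hω.sub_ramp _) ha ?_ hk)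
  refine tripleZeroDefect_eq_zero_iff.2 fun n => ?_
  rw [hω.momentX_sub_ramp _ n (p := (a, x)) ha, hcon n]
  ring

end

end RandomHeat

theorem lemma2p3 {Ω : Type*} [MeasurableSpace Ω] (P : Measure Ω) [IsProbabilityMeasure P]
    (B : ℝ → Ω → ℝ) (hB : RandomHeat.IsTwoSidedBrownian B P) :
    ∀ᵐ ω ∂P, ∀ u : ℝ → ℝ → ℝ, u = RandomHeat.velocity (fun y => B y ω) →
      ∀ t : ℝ, 0 < t →
      ∀ x ∈ RandomHeat.stableZeros u t ∪ RandomHeat.unstableZeros u t,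
      ∃ r : ℝ → ℝ,
        -- existence and uniqueness of the curve on `[0, t]`
        RandomHeat.IsZeroCurve u t x r ∧
        (∀ r' : ℝ → ℝ, RandomHeat.IsZeroCurve u t x r' → EqOn r' r (Icc 0 t)) ∧
        -- the stability type is kept along the curve
        (x ∈ RandomHeat.stableZeros u t →
          ∀ s ∈ Ioc 0 t, r s ∈ RandomHeat.stableZeros u s) ∧
        (x ∈ RandomHeat.unstableZeros u t →
          ∀ s ∈ Ioc 0 t, r s ∈ RandomHeat.unstableZeros u s) ∧
        -- smoothness, and the differential equation (with a left derivative at `s = t`)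
        ContDiffOn ℝ (⊤ : ℕ∞) r (Ioo 0 t) ∧
        ∀ s ∈ Ioc 0 t,
          HasDerivWithinAt r
            (-(RandomHeat.partialT u s (r s) / RandomHeat.partialX u s (r s))) (Icc 0 t) s ∧
          -(RandomHeat.partialT u s (r s) / RandomHeat.partialX u s (r s)) =
            -(RandomHeat.partialX (RandomHeat.partialX u) s (r s) /
              RandomHeat.partialX u s (r s)) := by
  obtain ⟨B', hB', hBB'⟩ := hB.exists_regular
  have hinj : ∀ᵐ ω ∂P, ∀ p q : ℚ, 0 ≤ p * q → p ≠ q → B' p ω ≠ B' q ω := by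
    simp only [ae_all_iff]
    intro p q h hne
    exact hB'.toIsTwoSidedBrownian.ae_ne (mod_cast h) (mod_cast hne)
  -- The four sign and space reflections of `B'` are again regular Brownian motions, which supplies
  -- high and low barriers on both sides.
  filter_upwards [hBB', ae_all_iff.2 fun q : ℚ => hB'.ae_roughness_ne_top q, hinj,
    hB'.ae_exists_momentX_ne_zero, hB'.ae_hasHighPoints, hB'.neg.ae_hasHighPoints,
    hB'.comp_neg.ae_hasHighPoints, hB'.comp_neg.neg.ae_hasHighPoints]
    with ω hω hrough hne hnd h1 h2 h3 h4 u hu t ht x hx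
  have hV := RandomHeat.barrierPair_of_path (hB'.continuous ω) hrough hne hnd h1 h2 h3 h4
  rw [funext hω, ← hu] at hV
  exact hV.exists_zeroCurve ht hx
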